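/- Fix a value $\theta$ of the control parameters (suppressed from the notation on $\mathcal M$, $g$, $\mathcal S$, $p$). Let $\mathcal M\subseteq\mathbb R^n$ be a domain (nonempty, open, connected), the set of admissible values of the stochastic variables $I=(I^1,\dots,I^n)$. Let $g=(g_{ij})$ be a $C^2$ Riemannian metric on $\mathcal M$ and $\mathcal S:\mathcal M\to\mathbb R$ a $C^2$ function (the information potential). Let $d\mu(I)=\sqrt{|\det(g_{ij}(I)/2\pi)|}\,dI$ be the invariant volume element on $\mathcal M$. The length of a $C^1$ curve $I:[a,b]\to\mathcal M$ is $\int_{a}^{b}\sqrt{g_{ij}(I(t))\dot I^i(t)\dot I^j(t)}\,dt$; $\mathfrak D(P,Q)$ denotes the infimum of the lengths of the $C^1$ curves in $\mathcal M$ from $P$ to $Q$; and a geodesic is a $C^1$ curve in $\mathcal M$ of minimal length among all $C^1$ curves in $\mathcal M$ with the same end points. Assume that: 1. $dp=e^{\mathcal S(I)}\,d\mu(I)$ is a probability distribution on $\mathcal M$. 2. For every geodesic $I_g(t)$ with $g_{ij}\dot I_g^i\dot I_g^j=1$, writing $\Phi(t)=\frac{d}{dt}\mathcal S(I_g(t))$,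 the length of $I_g$ on every parameter interval $(t_1,t_2)$ equals $\Phi(t_1)-\Phi(t_2)$. 3. The probability weight $\omega=e^{\mathcal S}$ (the density of $p$ with respect to the invariant volume $\mu$) vanishes on the boundary of $\mathcal M$: $\omega(I)\to0$ as $I\in\mathcal M$ tends to any point of $\partial\mathcal M$, and as $|I|\to\infty$ in $\mathcal M$ if $\mathcal M$ is unbounded. Then $\mathcal S$ has exactly one stationary point $\bar I\in\mathcal M$, and $\bar I$ is its unique global maximum. There is a constant $Z=Z(\theta)>0$ with $\mathcal S(\bar I)=-\log Z$, $$Z=\int_{\mathcal M}\exp\!\Big[-\tfrac12\,\mathfrak D(I,\bar I)^2\Big]d\mu(I)\qquad\text{and}\qquad dp(I)=\frac1{Z}\,\exp\!\Big[-\tfrac12\,\mathfrak D(I,\bar I)^2\Big]\,d\mu(I).$$ Consequently the metric and the point $\bar I$ alone determine the distribution: if $\mathcal S'$ and $p'$ also satisfy all of the above with the same $\mathcal M$ and $g$, and $\mathcal S'$ attains its maximum over $\mathcal M$ at $\bar I$, then $p'=p$. -/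

import Mathlib

open MeasureTheory Set Filter Topology

noncomputable section

namespace FluctuationGeometry

/-- The quadratic form `g_{ij}(x) v^i v^j` of the metric tensor `g` at the point `x`. -/
def quadForm {n : ℕ} (g : EuclideanSpace ℝ (Fin n) → Matrix (Fin n) (Fin n) ℝ)
    (x v : EuclideanSpace ℝ (Fin n)) : ℝ :=
  ∑ i, ∑ j, g x i j * v i * v j

/-- The length `∫_a^b √(g_{ij}(γ(t)) γ̇^i(t) γ̇^j(t)) dt` of the curve `γ` between the parameter
values `a` and `b`. -/
def length {n : ℕ} (g : EuclideanSpace ℝ (Fin n) → Matrix (Fin n) (Fin n) ℝ)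
    (γ : ℝ → EuclideanSpace ℝ (Fin n)) (a b : ℝ) : ℝ :=
  ∫ t in a..b, Real.sqrt (quadForm g (γ t) (deriv γ t))

/-- `γ`, restricted to `[a, b]`, is a continuously differentiable curve in `U` from `P` to `Q`. -/
structure IsCurve {n : ℕ} (U : Set (EuclideanSpace ℝ (Fin n)))
    (γ : ℝ → EuclideanSpace ℝ (Fin n)) (a b : ℝ) (P Q : EuclideanSpace ℝ (Fin n)) : Prop where
  le : a ≤ b
  contDiffOn : ContDiffOn ℝ 1 γ (Icc a b)
  mapsTo : MapsTo γ (Icc a b) U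
  source : γ a = P
  target : γ b = Q

/-- The distance `𝔇(P, Q)`: the minimal length (infimum of the lengths) of the curves in `U`
from `P` to `Q`. -/
def distance {n : ℕ} (U : Set (EuclideanSpace ℝ (Fin n)))
    (g : EuclideanSpace ℝ (Fin n) → Matrix (Fin n) (Fin n) ℝ)
    (P Q : EuclideanSpace ℝ (Fin n)) : ℝ :=
  sInf {L : ℝ | ∃ (γ : ℝ → EuclideanSpace ℝ (Fin n)) (a b : ℝ),
    IsCurve U γ a b P Q ∧ L = length g γ a b}

/-- `γ`, restricted to `[a, b]`, is a geodesic: a curve of minimal length among all curves in `U`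
with the same end points. -/
structure IsGeodesic {n : ℕ} (U : Set (EuclideanSpace ℝ (Fin n)))
    (g : EuclideanSpace ℝ (Fin n) → Matrix (Fin n) (Fin n) ℝ)
    (γ : ℝ → EuclideanSpace ℝ (Fin n)) (a b : ℝ) : Prop where
  isCurve : IsCurve U γ a b (γ a) (γ b)
  minimal : ∀ (c : ℝ → EuclideanSpace ℝ (Fin n)) (a' b' : ℝ),
    IsCurve U c a' b' (γ a) (γ b) → length g γ a b ≤ length g c a' b'

/-- `γ` has a unitary affine parametrization on `(a, b)`: `g_{ij}(γ) γ̇^i γ̇^j = 1`. -/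
def IsUnitary {n : ℕ} (g : EuclideanSpace ℝ (Fin n) → Matrix (Fin n) (Fin n) ℝ)
    (γ : ℝ → EuclideanSpace ℝ (Fin n)) (a b : ℝ) : Prop :=
  ∀ t ∈ Ioo a b, quadForm g (γ t) (deriv γ t) = 1

/-- The information dissipation `Φ(t) = d S(γ(t)) / dt` along the curve `γ`. -/
def dissipation {n : ℕ} (S : EuclideanSpace ℝ (Fin n) → ℝ)
    (γ : ℝ → EuclideanSpace ℝ (Fin n)) (t : ℝ) : ℝ :=
  deriv (fun s => S (γ s)) t

/-- The invariant volume element `dμ = √|det (g_{ij} / 2π)| dI` on `U`. -/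
def invariantVolume {n : ℕ} (U : Set (EuclideanSpace ℝ (Fin n)))
    (g : EuclideanSpace ℝ (Fin n) → Matrix (Fin n) (Fin n) ℝ) :
    Measure (EuclideanSpace ℝ (Fin n)) :=
  (volume.restrict U).withDensity
    (fun x => ENNReal.ofReal (Real.sqrt |((2 * Real.pi)⁻¹ • g x).det|))

/-- The axioms of fluctuation geometry, for one value of the control parameters. The statistical
manifold is the domain `U ⊆ ℝⁿ` of admissible values of the stochastic variables, `g` is its metric
tensor, `S` the information potential and `p` the probability distribution. Values of `g` and `S`
outside `U` play no role. -/
structure IsFluctuationGeometry {n : ℕ} (U : Set (EuclideanSpace ℝ (Fin n)))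
    (g : EuclideanSpace ℝ (Fin n) → Matrix (Fin n) (Fin n) ℝ)
    (S : EuclideanSpace ℝ (Fin n) → ℝ) (p : Measure (EuclideanSpace ℝ (Fin n))) : Prop where
  isOpen : IsOpen U
  isConnected : IsConnected U
  /-- `g` is a Riemannian metric on `U`. -/
  metric_contDiffOn : ∀ i j, ContDiffOn ℝ 2 (fun x => g x i j) U
  metric_posDef : ∀ x ∈ U, (g x).PosDef
  potential_contDiffOn : ContDiffOn ℝ 2 S U
  /-- `dp = exp(S) dμ`. -/
  distribution_eq :
    p = (invariantVolume U g).withDensity (fun x => ENNReal.ofReal (Real.exp (S x)))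
  isProbabilityMeasure : IsProbabilityMeasure p
  /-- On every interval of a geodesic with unitary affine parametrization, the length is the
  negative of the variation of the information dissipation. -/
  length_eq_dissipation : ∀ (γ : ℝ → EuclideanSpace ℝ (Fin n)) (a b : ℝ),
    IsGeodesic U g γ a b → IsUnitary g γ a b →
    ∀ t₁ t₂, a < t₁ → t₁ < t₂ → t₂ < b →
      length g γ t₁ t₂ = dissipation S γ t₁ - dissipation S γ t₂
  /-- The probability weight `ω = exp S`, that is, the (scalar) density of `p` with respect to the
  invariant volume, vanishes on the boundary of the manifold. -/
  weight_tendsto_frontier : ∀ b ∈ frontier U,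
    Tendsto (fun x => Real.exp (S x)) (𝓝[U] b) (𝓝 0)
  /-- The part at infinity of the boundary; there is none if `U` is bounded. -/
  weight_tendsto_infinity :
    Tendsto (fun x => Real.exp (S x))
      (Bornology.cobounded (EuclideanSpace ℝ (Fin n)) ⊓ 𝓟 U) (𝓝 0)

end FluctuationGeometry

end

noncomputable section

set_option maxSynthPendingDepth 3

/-! ### Linear algebra of the metric and its inverse. -/

namespace FluctuationGeometry

/-! The heart of the matter is the eikonal equation |∇S|² = 2(S(m) - S), where m is a maximum of S.
It says that √(2(S(m) - S)) has unit gradient where it is positive, so this function should be the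
distance to m. Then e^S = e^{S(m)} exp(-𝔇²/2), and the normalization of p forces Z = e^{-S(m)}.

Hypothesis 2 says that S has second derivative -1 along unit speed geodesics, that is, its covariant
Hessian is -g (`hessian_of_unit`, `hessian_quadratic`). Contracting with the gradient gives
d(|∇S|²/2 + S) = 0 (`hessian_gradient`, `exists_energy_const`). The constant is read off at a
maximum, which exists because hypothesis 3 makes the superlevel sets compact
(`isCompact_superlevel`).

A geodesic here is a minimizing curve, so hypothesis 2 can be used only once there is a minimizing
curve through each point in each direction. Hamilton's equations for the inverse metric supply the
curve (`exists_isHamiltonCurve`). A calibration, meaning a function f with f(γ(t)) = t and |df| ≤ 1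
near γ(0), shows that a short piece of it is minimizing (`exists_calibration`, `exists_isGeodesic`).

The global part rests on the gradient flow of S, which exists for all positive times inside a
compact superlevel set and along which the depth S(m) - S decays exactly like e^{-2t}. The flow
would push a path joining two maxima towards the maximal level, which is impossible because maxima
are isolated (`isMaxOn_unique`). The flow line from x then converges to m and, suitably
reparametrized, is a C¹ curve of length √(2(S(m) - S(x))) (`exists_curve_length_eq`). The eikonal
equation shows that no curve is shorter (`sqrt_le_length`). -/

/-- The metric tensor `g` at `x`, as a map from tangent vectors to covectors. -/
def metricForm {n : ℕ} (g : EuclideanSpace ℝ (Fin n) → Matrix (Fin n) (Fin n) ℝ)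
    (x : EuclideanSpace ℝ (Fin n)) :
    EuclideanSpace ℝ (Fin n) →L[ℝ] (EuclideanSpace ℝ (Fin n) →L[ℝ] ℝ) :=
  ∑ i, ∑ j, g x i j • (EuclideanSpace.proj i : EuclideanSpace ℝ (Fin n) →L[ℝ] ℝ).smulRight
    (EuclideanSpace.proj j : EuclideanSpace ℝ (Fin n) →L[ℝ] ℝ)

/-- The inverse metric at `x`, as a map from covectors to tangent vectors. -/
def cometric {n : ℕ} (g : EuclideanSpace ℝ (Fin n) → Matrix (Fin n) (Fin n) ℝ)
    (x : EuclideanSpace ℝ (Fin n)) :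
    (EuclideanSpace ℝ (Fin n) →L[ℝ] ℝ) →L[ℝ] EuclideanSpace ℝ (Fin n) :=
  (metricForm g x).inverse

/-- `g` is a Riemannian metric of class `C²` on the open set `U`. -/
structure IsRiemannianMetric {n : ℕ} (U : Set (EuclideanSpace ℝ (Fin n)))
    (g : EuclideanSpace ℝ (Fin n) → Matrix (Fin n) (Fin n) ℝ) : Prop where
  isOpen : IsOpen U
  contDiffOn : ∀ i j, ContDiffOn ℝ 2 (fun x => g x i j) U
  posDef : ∀ x ∈ U, (g x).PosDef

theorem IsFluctuationGeometry.isRiemannianMetric {n : ℕ} {U : Set (EuclideanSpace ℝ (Fin n))}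
    {g : EuclideanSpace ℝ (Fin n) → Matrix (Fin n) (Fin n) ℝ}
    {S : EuclideanSpace ℝ (Fin n) → ℝ} {p : Measure (EuclideanSpace ℝ (Fin n))}
    (h : IsFluctuationGeometry U g S p) : IsRiemannianMetric U g :=
  ⟨h.isOpen, h.metric_contDiffOn, h.metric_posDef⟩

theorem metricForm_apply {n : ℕ} (g : EuclideanSpace ℝ (Fin n) → Matrix (Fin n) (Fin n) ℝ)
    (x v w : EuclideanSpace ℝ (Fin n)) :
    metricForm g x v w = ∑ i, ∑ j, g x i j * v i * w j := by
  simp [metricForm, mul_assoc]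

theorem quadForm_eq {n : ℕ} (g : EuclideanSpace ℝ (Fin n) → Matrix (Fin n) (Fin n) ℝ)
    (x v : EuclideanSpace ℝ (Fin n)) : quadForm g x v = metricForm g x v v := by
  rw [metricForm_apply, quadForm]

namespace IsRiemannianMetric

variable {n : ℕ} {U : Set (EuclideanSpace ℝ (Fin n))}
  {g : EuclideanSpace ℝ (Fin n) → Matrix (Fin n) (Fin n) ℝ} (hg : IsRiemannianMetric U g)
include hg

theorem contDiffOn_metricForm : ContDiffOn ℝ 2 (metricForm g) U := by
  unfold metricForm
  exact ContDiffOn.sum fun i _ => ContDiffOn.sum fun j _ =>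
    (ContinuousLinearMap.toSpanSingleton ℝ _).contDiff.comp_contDiffOn (hg.contDiffOn i j)

theorem metricForm_symm {x : EuclideanSpace ℝ (Fin n)} (hx : x ∈ U)
    (v w : EuclideanSpace ℝ (Fin n)) : metricForm g x v w = metricForm g x w v := by
  rw [metricForm_apply, metricForm_apply, Finset.sum_comm]
  refine Finset.sum_congr rfl fun i _ => Finset.sum_congr rfl fun j _ => ?_
  have := (hg.posDef x hx).isHermitian.apply i j
  simp only [star_trivial] at this
  rw [this]; ring

theorem metricForm_pos {x : EuclideanSpace ℝ (Fin n)} (hx : x ∈ U)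
    {v : EuclideanSpace ℝ (Fin n)} (hv : v ≠ 0) : 0 < metricForm g x v v := by
  have h := (hg.posDef x hx).dotProduct_mulVec_pos (x := v.ofLp) (by simpa using hv)
  rw [metricForm_apply]
  refine h.trans_eq ?_
  simp only [dotProduct, Matrix.mulVec, star_trivial, Finset.mul_sum]
  refine Finset.sum_congr rfl fun i _ => Finset.sum_congr rfl fun j _ => ?_
  ring

theorem metricForm_nonneg {x : EuclideanSpace ℝ (Fin n)} (hx : x ∈ U)
    (v : EuclideanSpace ℝ (Fin n)) : 0 ≤ metricForm g x v v := by
  rcases eq_or_ne v 0 with rfl | hv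
  · simp
  · exact (hg.metricForm_pos hx hv).le

theorem isInvertible {x : EuclideanSpace ℝ (Fin n)} (hx : x ∈ U) :
    (metricForm g x).IsInvertible := by
  have hinj : Function.Injective (metricForm g x).toLinearMap := by
    rw [injective_iff_map_eq_zero]
    intro v hv
    by_contra hne
    have h1 := hg.metricForm_pos hx hne
    have h2 : metricForm g x v = 0 := hv
    rw [h2] at h1
    simp at h1
  have hrank : Module.finrank ℝ (EuclideanSpace ℝ (Fin n)) =
      Module.finrank ℝ (EuclideanSpace ℝ (Fin n) →L[ℝ] ℝ) :=
    (InnerProductSpace.toDual ℝ (EuclideanSpace ℝ (Fin n))).toLinearEquiv.finrank_eq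
  exact ⟨(LinearEquiv.ofInjectiveOfFinrankEq (metricForm g x).toLinearMap
    hinj hrank).toContinuousLinearEquiv, by ext v w; rfl⟩

theorem contDiffOn_cometric : ContDiffOn ℝ 2 (cometric g) U := fun x hx =>
  (hg.isInvertible hx).contDiffAt_map_inverse.comp_contDiffWithinAt x
    (hg.contDiffOn_metricForm x hx)

theorem metricForm_cometric {x : EuclideanSpace ℝ (Fin n)} (hx : x ∈ U)
    (p : EuclideanSpace ℝ (Fin n) →L[ℝ] ℝ) : metricForm g x (cometric g x p) = p := by
  simpa [cometric] using congrArg (fun f => f p) (hg.isInvertible hx).self_comp_inverse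

theorem cometric_metricForm {x : EuclideanSpace ℝ (Fin n)} (hx : x ∈ U)
    (v : EuclideanSpace ℝ (Fin n)) : cometric g x (metricForm g x v) = v := by
  simpa [cometric] using congrArg (fun f => f v) (hg.isInvertible hx).inverse_comp_self

theorem cometric_symm {x : EuclideanSpace ℝ (Fin n)} (hx : x ∈ U)
    (p q : EuclideanSpace ℝ (Fin n) →L[ℝ] ℝ) : p (cometric g x q) = q (cometric g x p) := by
  have := hg.metricForm_symm hx (cometric g x p) (cometric g x q)
  rwa [hg.metricForm_cometric hx, hg.metricForm_cometric hx] at this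

theorem cometric_nonneg {x : EuclideanSpace ℝ (Fin n)} (hx : x ∈ U)
    (p : EuclideanSpace ℝ (Fin n) →L[ℝ] ℝ) : 0 ≤ p (cometric g x p) := by
  have := hg.metricForm_nonneg hx (cometric g x p)
  rwa [hg.metricForm_cometric hx] at this

theorem cometric_eq_zero {x : EuclideanSpace ℝ (Fin n)} (hx : x ∈ U)
    {p : EuclideanSpace ℝ (Fin n) →L[ℝ] ℝ} (hp : p (cometric g x p) = 0) : p = 0 := by
  by_contra hne
  have h0 : cometric g x p ≠ 0 := by
    intro h0
    have := hg.metricForm_cometric hx p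
    rw [h0, map_zero] at this
    exact hne this.symm
  have := hg.metricForm_pos hx h0
  rw [hg.metricForm_cometric hx, hp] at this
  exact lt_irrefl _ this

/-- The Cauchy-Schwarz inequality for the pairing of a covector and a vector. -/
theorem sq_apply_le {x : EuclideanSpace ℝ (Fin n)} (hx : x ∈ U)
    (p : EuclideanSpace ℝ (Fin n) →L[ℝ] ℝ) (w : EuclideanSpace ℝ (Fin n)) :
    p w ^ 2 ≤ p (cometric g x p) * metricForm g x w w := by
  have key : ∀ s : ℝ, 0 ≤ p (cometric g x p) * (s * s) + (-2 * p w) * s + metricForm g x w w := by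
    intro s
    have h := hg.metricForm_nonneg hx (w - s • cometric g x p)
    have h1 := hg.metricForm_symm hx w (cometric g x p)
    simp only [map_sub, map_smul, sub_apply, smul_apply,
      hg.metricForm_cometric hx, smul_eq_mul, h1] at h
    linarith
  have := discrim_le_zero key
  rw [discrim] at this
  linarith

theorem abs_apply_le {x : EuclideanSpace ℝ (Fin n)} (hx : x ∈ U)
    (p : EuclideanSpace ℝ (Fin n) →L[ℝ] ℝ) (w : EuclideanSpace ℝ (Fin n)) :
    |p w| ≤ Real.sqrt (p (cometric g x p)) * Real.sqrt (metricForm g x w w) := by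
  rw [← Real.sqrt_mul (hg.cometric_nonneg hx p)]
  exact Real.abs_le_sqrt (hg.sq_apply_le hx p w)

end IsRiemannianMetric

/-! ### Lower bounds for the length of curves. -/

namespace IsRiemannianMetric

variable {n : ℕ} {U : Set (EuclideanSpace ℝ (Fin n))}
  {g : EuclideanSpace ℝ (Fin n) → Matrix (Fin n) (Fin n) ℝ} (hg : IsRiemannianMetric U g)
include hg

/-- The speed of a `C¹` curve in `U` is integrable. -/
theorem integrableOn_speed {c : ℝ → EuclideanSpace ℝ (Fin n)} {a b : ℝ}
    (hc : ContDiffOn ℝ 1 c (Icc a b)) (hU : MapsTo c (Icc a b) U) :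
    IntegrableOn (fun t => Real.sqrt (quadForm g (c t) (deriv c t))) (Icc a b) := by
  rcases le_or_gt b a with hab | hab
  · have : volume (Icc a b) = 0 := by rw [Real.volume_Icc]; simpa using hab
    exact IntegrableOn.of_measure_zero this
  have hv : ContinuousOn (derivWithin c (Icc a b)) (Icc a b) :=
    hc.continuousOn_derivWithin (uniqueDiffOn_Icc hab) le_rfl
  have hA : ContinuousOn (fun t => metricForm g (c t)) (Icc a b) :=
    hg.contDiffOn_metricForm.continuousOn.comp hc.continuousOn hU
  have hcont : ContinuousOn (fun t => Real.sqrt (quadForm g (c t) (derivWithin c (Icc a b) t)))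
      (Icc a b) := by
    simp only [quadForm_eq]
    exact ((hA.clm_apply hv).clm_apply hv).sqrt
  have hint := hcont.integrableOn_compact (μ := volume) isCompact_Icc
  -- At the end points `deriv c` is unrelated to the one-sided derivative, but these points are
  -- null.
  rw [integrableOn_Icc_iff_integrableOn_Ioo] at hint ⊢
  refine hint.congr_fun (fun t ht => ?_) measurableSet_Ioo
  simp only
  rw [derivWithin_of_mem_nhds (Icc_mem_nhds ht.1 ht.2)]

theorem length_le_length {c : ℝ → EuclideanSpace ℝ (Fin n)} {a b τ : ℝ}
    (hc : ContDiffOn ℝ 1 c (Icc a b)) (hU : MapsTo c (Icc a b) U) (h₁ : a ≤ τ) (h₂ : τ ≤ b) :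
    length g c a τ ≤ length g c a b := by
  have hint := hg.integrableOn_speed hc hU
  refine intervalIntegral.integral_mono_interval le_rfl h₁ h₂
    (Eventually.of_forall fun _ => Real.sqrt_nonneg _) ?_
  rw [intervalIntegrable_iff_integrableOn_Icc_of_le (h₁.trans h₂)]
  exact hint

/-- The length of a curve dominates the increment of any function whose differential has norm
at most one along the curve. -/
theorem sub_le_length {c : ℝ → EuclideanSpace ℝ (Fin n)} {a b : ℝ} (hab : a ≤ b)
    (hc : ContDiffOn ℝ 1 c (Icc a b)) (hU : MapsTo c (Icc a b) U)
    {f : EuclideanSpace ℝ (Fin n) → ℝ}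
    {f' : EuclideanSpace ℝ (Fin n) → EuclideanSpace ℝ (Fin n) →L[ℝ] ℝ}
    (hf : ∀ t ∈ Icc a b, HasFDerivAt f (f' (c t)) (c t))
    (hle : ∀ t ∈ Icc a b, ∀ w, f' (c t) w ≤ Real.sqrt (metricForm g (c t) w w)) :
    f (c b) - f (c a) ≤ length g c a b := by
  refine intervalIntegral.sub_le_integral_of_hasDeriv_right_of_le hab (g := f ∘ c)
    (g' := fun t => f' (c t) (deriv c t)) ?_ ?_ (hg.integrableOn_speed hc hU) ?_
  · exact fun t ht => (hf t ht).continuousAt.comp_continuousWithinAt (hc.continuousOn t ht)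
  · intro t ht
    have hd : HasDerivAt c (deriv c t) t :=
      ((hc.differentiableOn one_ne_zero t (Ioo_subset_Icc_self ht)).differentiableAt
        (Icc_mem_nhds ht.1 ht.2)).hasDerivAt
    exact ((hf t (Ioo_subset_Icc_self ht)).comp_hasDerivAt t hd).hasDerivWithinAt
  · intro t ht
    rw [quadForm_eq]
    exact hle t (Ioo_subset_Icc_self ht) _

/-- Near each point, the metric dominates a multiple of the euclidean one. -/
theorem exists_mul_norm_le {x₀ : EuclideanSpace ℝ (Fin n)} (hx₀ : x₀ ∈ U) :
    ∃ k > 0, ∃ ρ > 0, Metric.closedBall x₀ ρ ⊆ U ∧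
      ∀ x ∈ Metric.closedBall x₀ ρ, ∀ w, k * ‖w‖ ≤ Real.sqrt (metricForm g x w w) := by
  have hU := hg.isOpen.mem_nhds hx₀
  have hG : ContinuousAt (fun x => ‖cometric g x‖) x₀ :=
    ((hg.contDiffOn_cometric x₀ hx₀).contDiffAt hU).continuousAt.norm
  set C := ‖cometric g x₀‖ + 1 with hC
  have hCpos : 0 < C := by positivity
  have hev : ∀ᶠ x in 𝓝 x₀, x ∈ U ∧ ‖cometric g x‖ < C := by
    refine Filter.Eventually.and hU (hG.eventually_lt continuousAt_const ?_)
    simp [hC]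
  obtain ⟨ρ, hρ, hball⟩ := Metric.nhds_basis_closedBall.eventually_iff.mp hev
  refine ⟨(Real.sqrt C)⁻¹, by positivity, ρ, hρ, fun x hx => (hball hx).1, fun x hx w => ?_⟩
  obtain ⟨hxU, hxC⟩ := hball hx
  -- For a covector u of norm at most one with u(w) = ‖w‖, Cauchy-Schwarz gives ‖w‖ ≤ √C √g(w, w),
  -- since the inverse metric is bounded by C near x₀.
  obtain ⟨u, hu1, hu⟩ := exists_dual_vector'' ℝ w
  simp only [RCLike.ofReal_real_eq_id, id_eq] at hu
  have h1 := hg.abs_apply_le hxU u w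
  have h2 : u (cometric g x u) ≤ C := by
    refine (le_abs_self _).trans ((u.le_opNorm _).trans ?_)
    refine (mul_le_mul hu1 ((cometric g x).le_opNorm u) (norm_nonneg _) zero_le_one).trans ?_
    rw [one_mul]
    calc ‖cometric g x‖ * ‖u‖ ≤ C * 1 := mul_le_mul hxC.le hu1 (norm_nonneg _) hCpos.le
      _ = C := mul_one C
  rw [hu, abs_of_nonneg (norm_nonneg w)] at h1
  rw [inv_mul_le_iff₀ (by positivity)]
  exact h1.trans (mul_le_mul_of_nonneg_right (Real.sqrt_le_sqrt h2) (Real.sqrt_nonneg _))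

/-- A curve that leaves a ball around its starting point has at least a certain length. -/
theorem mul_le_length_of_exit {x₀ : EuclideanSpace ℝ (Fin n)} {k ρ : ℝ} (hk : 0 < k)
    (hkρ : ∀ x ∈ Metric.closedBall x₀ ρ, ∀ w, k * ‖w‖ ≤ Real.sqrt (metricForm g x w w))
    {c : ℝ → EuclideanSpace ℝ (Fin n)} {a b : ℝ}
    (hc : ContDiffOn ℝ 1 c (Icc a b)) (hU : MapsTo c (Icc a b) U)
    (ha : ‖c a - x₀‖ ≤ ρ / 2) {t : ℝ} (ht : t ∈ Icc a b) (hexit : ρ ≤ ‖c t - x₀‖) :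
    k * (ρ / 2) ≤ length g c a b := by
  let s : Set ℝ := Icc a b ∩ (fun t => ‖c t - x₀‖) ⁻¹' Ici ρ
  have hcont : ContinuousOn (fun t => ‖c t - x₀‖) (Icc a b) :=
    (hc.continuousOn.sub continuousOn_const).norm
  have hs : IsCompact s :=
    isCompact_Icc.of_isClosed_subset (hcont.preimage_isClosed_of_isClosed isClosed_Icc isClosed_Ici)
      inter_subset_left
  -- Up to the first exit time τ the curve stays in the closed ball. There k times a norming
  -- functional of c(τ) - c(a) has g-norm at most one, so `sub_le_length` applies to it.
  obtain ⟨τ, ⟨hτ, hτρ⟩, hmin⟩ := hs.exists_isLeast ⟨t, ht, hexit⟩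
  have hτρ : ρ ≤ ‖c τ - x₀‖ := hτρ
  have hbefore : ∀ r ∈ Ico a τ, ‖c r - x₀‖ < ρ := by
    intro r hr
    by_contra hge
    exact absurd (hmin ⟨⟨hr.1, hr.2.le.trans hτ.2⟩, not_lt.mp hge⟩) (not_le.mpr hr.2)
  have hball : ∀ r ∈ Icc a τ, c r ∈ Metric.closedBall x₀ ρ := by
    intro r hr
    rw [mem_closedBall_iff_norm]
    rcases eq_or_lt_of_le hr.1 with h | h
    · rw [← h]; linarith [norm_nonneg (c a - x₀)]
    · have hcl : r ∈ closure (Ico a τ) := by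
        rw [closure_Ico (h.trans_le hr.2).ne]; exact hr
      refine ContinuousWithinAt.closure_le hcl ?_
        continuousWithinAt_const fun y hy => (hbefore y hy).le
      exact (hcont r ⟨hr.1, hr.2.trans hτ.2⟩).mono
        (Ico_subset_Icc_self.trans (Icc_subset_Icc_right hτ.2))
  have hsub : Icc a τ ⊆ Icc a b := Icc_subset_Icc_right hτ.2
  obtain ⟨u, hu1, hu⟩ := exists_dual_vector'' ℝ (c τ - c a)
  simp only [RCLike.ofReal_real_eq_id, id_eq] at hu
  have h1 := hg.sub_le_length hτ.1 (hc.mono hsub) (hU.mono_left hsub) (f := fun x => (k • u) x)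
    (f' := fun _ => k • u) (fun r _ => (k • u).hasFDerivAt) fun r hr w => by
      refine le_trans ?_ (hkρ (c r) (hball r hr) w)
      simp only [smul_apply, smul_eq_mul]
      refine mul_le_mul_of_nonneg_left ?_ hk.le
      refine (le_abs_self _).trans ((u.le_opNorm w).trans ?_)
      exact mul_le_of_le_one_left (norm_nonneg w) hu1
  have h2 : ρ / 2 ≤ ‖c τ - c a‖ := by
    have : ‖c τ - x₀‖ ≤ ‖c τ - c a‖ + ‖c a - x₀‖ := norm_sub_le_norm_sub_add_norm_sub _ _ _
    linarith
  have h3 : (k • u) (c τ) - (k • u) (c a) = k * ‖c τ - c a‖ := by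
    rw [← map_sub, smul_apply, hu, smul_eq_mul]
  rw [h3] at h1
  exact (mul_le_mul_of_nonneg_left h2 hk.le).trans
    (h1.trans (hg.length_le_length hc hU hτ.1 hτ.2))

end IsRiemannianMetric

/-! ### A Taylor estimate, and the geodesic equations in hamiltonian form. -/

/-- The second order Taylor estimate, locally uniform in the base point. -/
theorem exists_taylor_bound {F : Type*} [NormedAddCommGroup F] [NormedSpace ℝ F] {H : F → ℝ}
    {z₀ : F} (hH : ContDiffAt ℝ 2 H z₀) :
    ∃ C ≥ 0, ∃ r > 0, ∀ z ∈ Metric.ball z₀ r, ∀ z' ∈ Metric.ball z₀ r,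
      |H z' - H z - fderiv ℝ H z (z' - z)| ≤ C * ‖z' - z‖ ^ 2 := by
  have h1 : ContDiffAt ℝ 1 (fderiv ℝ H) z₀ := hH.fderiv_right (by norm_num)
  obtain ⟨K, s, hs, hK⟩ := h1.exists_lipschitzOnWith
  have hd : ∀ᶠ z in 𝓝 z₀, DifferentiableAt ℝ H z := by
    filter_upwards [hH.eventually (by simp)] with z hz
    exact hz.differentiableAt (by simp)
  obtain ⟨r, hr, hball⟩ := Metric.nhds_basis_ball.eventually_iff.mp (hd.and hs)
  refine ⟨K, K.2, r, hr, fun z hz z' hz' => ?_⟩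
  have hseg : segment ℝ z z' ⊆ Metric.ball z₀ r := (convex_ball z₀ r).segment_subset hz hz'
  -- Mean value inequality for H minus its linear part at z: on the segment the derivative differs
  -- from that at z by at most K‖z' - z‖.
  have h2 := Convex.norm_image_sub_le_of_norm_hasFDerivWithin_le' (f := H) (f' := fderiv ℝ H)
    (φ := fderiv ℝ H z) (C := K * ‖z' - z‖) (s := segment ℝ z z')
    (fun w hw => (hball (hseg hw)).1.hasFDerivAt.hasFDerivWithinAt)
    (fun w hw => by
      refine (hK.norm_sub_le (hball (hseg hw)).2 (hball hz).2).trans ?_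
      refine mul_le_mul_of_nonneg_left ?_ K.2
      obtain ⟨θ, hθ, rfl⟩ := (segment_eq_image' ℝ z z').subset hw
      simp only [add_sub_cancel_left, norm_smul, Real.norm_eq_abs, abs_of_nonneg hθ.1]
      exact mul_le_of_le_one_left (norm_nonneg _) hθ.2)
    (convex_segment z z') (left_mem_segment ℝ z z') (right_mem_segment ℝ z z')
  rw [Real.norm_eq_abs] at h2
  exact h2.trans_eq (by ring)

/-- The inverse metric as a function of position and momentum. -/
def hamiltonian {n : ℕ} (g : EuclideanSpace ℝ (Fin n) → Matrix (Fin n) (Fin n) ℝ)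
    (z : EuclideanSpace ℝ (Fin n) × (EuclideanSpace ℝ (Fin n) →L[ℝ] ℝ)) : ℝ :=
  z.2 (cometric g z.1 z.2)

/-- The position derivative of half the hamiltonian, with the opposite sign. -/
def force {n : ℕ} (g : EuclideanSpace ℝ (Fin n) → Matrix (Fin n) (Fin n) ℝ)
    (z : EuclideanSpace ℝ (Fin n) × (EuclideanSpace ℝ (Fin n) →L[ℝ] ℝ)) :
    EuclideanSpace ℝ (Fin n) →L[ℝ] ℝ :=
  (-(1 / 2) : ℝ) • (fderiv ℝ (hamiltonian g) z).comp (ContinuousLinearMap.inl ℝ _ _)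

/-- A solution of the equations of unit speed geodesics, in hamiltonian form. -/
structure IsHamiltonCurve {n : ℕ} (U : Set (EuclideanSpace ℝ (Fin n)))
    (g : EuclideanSpace ℝ (Fin n) → Matrix (Fin n) (Fin n) ℝ) (γ : ℝ → EuclideanSpace ℝ (Fin n))
    (P : ℝ → EuclideanSpace ℝ (Fin n) →L[ℝ] ℝ) (ε : ℝ) : Prop where
  pos : 0 < ε
  mem : ∀ t ∈ Ioo (-ε) ε, γ t ∈ U
  hasDerivAt_position : ∀ t ∈ Ioo (-ε) ε, HasDerivAt γ (cometric g (γ t) (P t)) t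
  hasDerivAt_momentum : ∀ t ∈ Ioo (-ε) ε, HasDerivAt P (force g (γ t, P t)) t
  energy : ∀ t ∈ Ioo (-ε) ε, P t (cometric g (γ t) (P t)) = 1

namespace IsRiemannianMetric

variable {n : ℕ} {U : Set (EuclideanSpace ℝ (Fin n))}
  {g : EuclideanSpace ℝ (Fin n) → Matrix (Fin n) (Fin n) ℝ} (hg : IsRiemannianMetric U g)
include hg

theorem contDiffAt_cometric {x : EuclideanSpace ℝ (Fin n)} (hx : x ∈ U) :
    ContDiffAt ℝ 2 (cometric g) x :=
  (hg.contDiffOn_cometric x hx).contDiffAt (hg.isOpen.mem_nhds hx)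

theorem contDiffAt_hamiltonian {x : EuclideanSpace ℝ (Fin n)} (hx : x ∈ U)
    (p : EuclideanSpace ℝ (Fin n) →L[ℝ] ℝ) : ContDiffAt ℝ 2 (hamiltonian g) (x, p) := by
  have h1 : ContDiffAt ℝ 2 (fun z : EuclideanSpace ℝ (Fin n) × (EuclideanSpace ℝ (Fin n) →L[ℝ] ℝ)
      => cometric g z.1) (x, p) :=
    ContDiffAt.comp (x, p) (g := cometric g) (f := Prod.fst) (hg.contDiffAt_cometric hx)
      contDiffAt_fst
  exact contDiffAt_snd.clm_apply (h1.clm_apply contDiffAt_snd)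

theorem fderiv_hamiltonian {x : EuclideanSpace ℝ (Fin n)} (hx : x ∈ U)
    (p δ : EuclideanSpace ℝ (Fin n) →L[ℝ] ℝ) (y : EuclideanSpace ℝ (Fin n)) :
    fderiv ℝ (hamiltonian g) (x, p) (y, δ) =
      p (fderiv ℝ (cometric g) x y p) + 2 * δ (cometric g x p) := by
  have hG : HasFDerivAt (cometric g) (fderiv ℝ (cometric g) x) x :=
    ((hg.contDiffAt_cometric hx).differentiableAt (by simp)).hasFDerivAt
  have h1 : HasFDerivAt (fun z : EuclideanSpace ℝ (Fin n) × (EuclideanSpace ℝ (Fin n) →L[ℝ] ℝ)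
      => cometric g z.1)
      ((fderiv ℝ (cometric g) x).comp (ContinuousLinearMap.fst ℝ _ _)) (x, p) :=
    HasFDerivAt.comp (x, p) (g := cometric g) (f := Prod.fst) hG hasFDerivAt_fst
  have h2 := (hasFDerivAt_snd (𝕜 := ℝ) (p := (x, p))).clm_apply
    (h1.clm_apply (hasFDerivAt_snd (𝕜 := ℝ) (p := (x, p))))
  have h3 : fderiv ℝ (hamiltonian g) (x, p) = _ := h2.fderiv
  rw [h3]
  have := hg.cometric_symm hx p δ
  simp [this]
  ring

theorem force_apply {x : EuclideanSpace ℝ (Fin n)} (hx : x ∈ U)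
    (p : EuclideanSpace ℝ (Fin n) →L[ℝ] ℝ) (y : EuclideanSpace ℝ (Fin n)) :
    force g (x, p) y = -(1 / 2) * p (fderiv ℝ (cometric g) x y p) := by
  have := hg.fderiv_hamiltonian hx p 0 y
  simp only [zero_apply, mul_zero, add_zero] at this
  rw [← this]
  simp [force]

/-- Picard-Lindelöf in phase space, where the vector field is C¹ because the metric is C². The
energy keeps its initial value 1, since the position and momentum contributions to its derivative
cancel. -/
theorem exists_isHamiltonCurve {x : EuclideanSpace ℝ (Fin n)} (hx : x ∈ U)
    {p : EuclideanSpace ℝ (Fin n) →L[ℝ] ℝ} (hp : p (cometric g x p) = 1) :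
    ∃ γ P ε, IsHamiltonCurve U g γ P ε ∧ γ 0 = x ∧ P 0 = p := by
  have hH := hg.contDiffAt_hamiltonian hx p
  have h1 : ContDiffAt ℝ 1 (fun z : EuclideanSpace ℝ (Fin n) × (EuclideanSpace ℝ (Fin n) →L[ℝ] ℝ)
      => (cometric g z.1 z.2, force g z)) (x, p) := by
    refine ContDiffAt.prodMk ?_ ?_
    · exact (ContDiffAt.comp (x, p) (g := cometric g) (f := Prod.fst)
        ((hg.contDiffAt_cometric hx).of_le (by norm_num)) contDiffAt_fst).clm_apply contDiffAt_snd
    · exact (contDiffAt_const (c := (-(1 / 2) : ℝ))).smul ((hH.fderiv_right (m := 1) (by norm_num)).clm_comp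
        (contDiffAt_const (c := ContinuousLinearMap.inl ℝ (EuclideanSpace ℝ (Fin n)) _)))
  obtain ⟨α, hα0, ε, hε, hα⟩ :=
    h1.exists_forall_mem_closedBall_exists_eq_forall_mem_Ioo_hasDerivAt₀ 0
  simp only [zero_sub, zero_add] at hα
  have hcont : ContinuousAt (fun t => (α t).1) 0 :=
    (hα 0 ⟨by linarith, hε⟩).continuousAt.fst
  have hev : ∀ᶠ t in 𝓝 (0 : ℝ), (α t).1 ∈ U := by
    refine hcont.eventually (hg.isOpen.mem_nhds ?_)
    simpa [hα0] using hx
  obtain ⟨ε', hε', hU⟩ := Metric.nhds_basis_ball.eventually_iff.mp hev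
  set e := min ε ε' with he
  have hepos : 0 < e := lt_min hε hε'
  have hsub : ∀ t ∈ Ioo (-e) e, t ∈ Ioo (-ε) ε ∧ (α t).1 ∈ U := by
    intro t ht
    have h1 : e ≤ ε := min_le_left _ _
    have h2 : e ≤ ε' := min_le_right _ _
    refine ⟨⟨by linarith [ht.1], by linarith [ht.2]⟩, hU ?_⟩
    rw [mem_ball_zero_iff, Real.norm_eq_abs, abs_lt]
    exact ⟨by linarith [ht.1], by linarith [ht.2]⟩
  have hd : ∀ t ∈ Ioo (-e) e, HasDerivAt (fun t => hamiltonian g (α t)) 0 t := by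
    intro t ht
    obtain ⟨ht1, ht2⟩ := hsub t ht
    have h1 := (((hg.contDiffAt_hamiltonian ht2 (α t).2).differentiableAt
      (by simp)).hasFDerivAt).comp_hasDerivAt t (hα t ht1)
    rw [hg.fderiv_hamiltonian ht2, hg.force_apply ht2] at h1
    convert! h1 using 1
    ring
  have h0 : (0 : ℝ) ∈ Ioo (-e) e := ⟨by linarith, hepos⟩
  refine ⟨fun t => (α t).1, fun t => (α t).2, e, ⟨hepos, fun t ht => (hsub t ht).2,
    fun t ht => (hα t (hsub t ht).1).fst, fun t ht => (hα t (hsub t ht).1).snd, fun t ht => ?_⟩,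
    by simp [hα0], by simp [hα0]⟩
  have hconst := isOpen_Ioo.is_const_of_deriv_eq_zero isPreconnected_Ioo
    (fun t ht => (hd t ht).differentiableAt.differentiableWithinAt)
    (fun t ht => (hd t ht).deriv) ht h0
  simp only [hamiltonian, hα0] at hconst
  rw [hconst, hp]

end IsRiemannianMetric

/-! ### Calibration of hamiltonian curves. -/

/-- A local inverse of a function with derivative one at the origin, differentiable on a
neighbourhood. -/
theorem exists_local_inverse {ψ ψ' : ℝ → ℝ} (hψ : ∀ᶠ t in 𝓝 0, HasDerivAt ψ (ψ' t) t)
    (hψ' : ContinuousAt ψ' 0) (h1 : ψ' 0 = 1) :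
    ∃ φ : ℝ → ℝ, (∀ᶠ t in 𝓝 0, φ (ψ t) = t) ∧
      ∀ᶠ u in 𝓝 (ψ 0), HasDerivAt φ (ψ' (φ u))⁻¹ u := by
  have hs : HasStrictDerivAt ψ 1 0 := h1 ▸ hasStrictDerivAt_of_hasDerivAt_of_continuousAt hψ hψ'
  have hs' := hs.hasStrictFDerivAt_equiv one_ne_zero
  have hloc := hs.to_localInverse one_ne_zero
  set φ := hs.localInverse ψ 1 0 one_ne_zero with hφ
  have hleft : ∀ᶠ t in 𝓝 0, φ (ψ t) = t := hs'.eventually_left_inverse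
  have hright : ∀ᶠ u in 𝓝 (ψ 0), ψ (φ u) = u := hs'.eventually_right_inverse
  have hφ0 : φ (ψ 0) = 0 := hleft.self_of_nhds
  -- Strict differentiability at one point makes φ Lipschitz, hence continuous, on a neighbourhood.
  -- This is what differentiating the inverse at nearby points requires.
  obtain ⟨K, s, hsn, hK⟩ := hloc.hasStrictFDerivAt.exists_lipschitzOnWith
  have hcont : ∀ᶠ u in 𝓝 (ψ 0), ContinuousAt φ u := by
    filter_upwards [eventually_eventually_nhds.mpr hsn] with u hu
    exact hK.continuousOn.continuousAt hu
  have hφt : Tendsto φ (𝓝 (ψ 0)) (𝓝 0) := by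
    have := hcont.self_of_nhds.tendsto
    rwa [hφ0] at this
  have hne : ∀ᶠ t in 𝓝 0, ψ' t ≠ 0 := hψ'.eventually_ne (by rw [h1]; exact one_ne_zero)
  refine ⟨φ, hleft, ?_⟩
  filter_upwards [hcont, hφt.eventually hψ, hφt.eventually hne,
    eventually_eventually_nhds.mpr hright] with u hu1 hu2 hu3 hu4
  exact HasDerivAt.of_local_left_inverse hu1 hu2 hu3 hu4

/-- The derivative of `x ↦ τ(x) + P(τ(x)) y - K/2 τ(x) ‖y‖²` with `y = x - γ(τ(x))`, when `P` is
normalized on the velocity of `γ`. -/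
theorem hasFDerivAt_calibration {F : Type*} [NormedAddCommGroup F] [InnerProductSpace ℝ F]
    {γ : ℝ → F} {P : ℝ → F →L[ℝ] ℝ} {τ : F → ℝ} {x v : F} {q τ' : F →L[ℝ] ℝ} (K : ℝ)
    (hτ : HasFDerivAt τ τ' x) (hγ : HasDerivAt γ v (τ x)) (hP : HasDerivAt P q (τ x))
    (hv : P (τ x) v = 1) :
    HasFDerivAt (fun x => τ x + P (τ x) (x - γ (τ x)) - K / 2 * (τ x * ‖x - γ (τ x)‖ ^ 2))
      (P (τ x) + ((q (x - γ (τ x)) - K / 2 * ‖x - γ (τ x)‖ ^ 2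
          + K * τ x * inner ℝ (x - γ (τ x)) v) • τ'
        - (K * τ x) • innerSL ℝ (x - γ (τ x)))) x := by
  have hy : HasFDerivAt (fun x => x - γ (τ x)) (ContinuousLinearMap.id ℝ F - τ'.smulRight v) x := by
    have := hγ.hasFDerivAt.comp x hτ
    refine ((hasFDerivAt_id x).sub this).congr_fderiv ?_
    ext w; simp
  have hPτ : HasFDerivAt (fun x => P (τ x)) (τ'.smulRight q) x := by
    refine (hP.hasFDerivAt.comp x hτ).congr_fderiv ?_
    ext w; simp
  refine ((hτ.add (hPτ.clm_apply hy)).sub ((hτ.mul hy.norm_sq).const_mul (K / 2))).congr_fderiv ?_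
  generalize x - γ (τ x) = y
  ext w
  -- The normalization P(v) = 1 cancels the differential of τ against the term -P(v)τ' that comes
  -- from moving the foot point γ(τ).
  simp [hv]
  ring

/-- A bound for the correction of the momentum in `hasFDerivAt_calibration`. -/
theorem norm_calibration_correction_le {F : Type*} [NormedAddCommGroup F] [InnerProductSpace ℝ F]
    {y v : F} {q τ' : F →L[ℝ] ℝ} {B K t : ℝ} (hB : 0 ≤ B) (hK : 0 ≤ K) (hq : ‖q‖ ≤ B)
    (hv : ‖v‖ ≤ B) (hτ : ‖τ'‖ ≤ B) (hKt : K * |t| ≤ 1) (hKy : K * ‖y‖ ≤ 1) :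
    ‖(q y - K / 2 * ‖y‖ ^ 2 + K * t * inner ℝ y v) • τ' - (K * t) • innerSL ℝ y‖ ≤
      (1 + 2 * B ^ 2 + B) * ‖y‖ := by
  have hKtn : ‖K * t‖ ≤ 1 := by
    rwa [norm_mul, Real.norm_eq_abs, Real.norm_eq_abs, abs_of_nonneg hK]
  have hyn := norm_nonneg y
  have h1 : ‖q y‖ ≤ B * ‖y‖ :=
    (q.le_opNorm y).trans (mul_le_mul_of_nonneg_right hq hyn)
  have h2 : ‖K / 2 * ‖y‖ ^ 2‖ ≤ 1 * ‖y‖ := by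
    rw [Real.norm_eq_abs, abs_of_nonneg (by positivity)]
    have := mul_le_mul_of_nonneg_right hKy hyn
    nlinarith
  have h3 : ‖K * t * inner ℝ y v‖ ≤ B * ‖y‖ := by
    rw [norm_mul]
    have h4 : ‖(inner ℝ y v : ℝ)‖ ≤ ‖y‖ * B :=
      (norm_inner_le_norm y v).trans (mul_le_mul_of_nonneg_left hv hyn)
    calc ‖K * t‖ * ‖(inner ℝ y v : ℝ)‖ ≤ 1 * (‖y‖ * B) :=
          mul_le_mul hKtn h4 (norm_nonneg _) zero_le_one
      _ = B * ‖y‖ := by ring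
  have h4 : ‖q y - K / 2 * ‖y‖ ^ 2 + K * t * inner ℝ y v‖ ≤ (2 * B + 1) * ‖y‖ :=
    calc _ ≤ ‖q y‖ + ‖K / 2 * ‖y‖ ^ 2‖ + ‖K * t * inner ℝ y v‖ :=
          (norm_add_le _ _).trans (add_le_add_left (norm_sub_le _ _) _)
      _ ≤ (2 * B + 1) * ‖y‖ := by linarith
  have h5 : ‖(q y - K / 2 * ‖y‖ ^ 2 + K * t * inner ℝ y v) • τ'‖ ≤ (2 * B + 1) * ‖y‖ * B := by
    rw [norm_smul]
    exact mul_le_mul h4 hτ (norm_nonneg _) (by positivity)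
  have h6 : ‖(K * t) • innerSL ℝ y‖ ≤ 1 * ‖y‖ := by
    rw [norm_smul, innerSL_apply_norm]
    exact mul_le_mul_of_nonneg_right hKtn hyn
  calc _ ≤ _ := norm_sub_le _ _
    _ ≤ (1 + 2 * B ^ 2 + B) * ‖y‖ := by linarith

namespace IsHamiltonCurve

variable {n : ℕ} {U : Set (EuclideanSpace ℝ (Fin n))}
  {g : EuclideanSpace ℝ (Fin n) → Matrix (Fin n) (Fin n) ℝ} {γ : ℝ → EuclideanSpace ℝ (Fin n)}
  {P : ℝ → EuclideanSpace ℝ (Fin n) →L[ℝ] ℝ} {ε : ℝ} (h : IsHamiltonCurve U g γ P ε)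
include h

theorem zero_mem : (0 : ℝ) ∈ Ioo (-ε) ε := ⟨by linarith [h.pos], h.pos⟩

theorem mem_nhds : Ioo (-ε) ε ∈ 𝓝 (0 : ℝ) := Ioo_mem_nhds h.zero_mem.1 h.zero_mem.2

variable (hg : IsRiemannianMetric U g)
include hg

theorem continuousAt_velocity {t : ℝ} (ht : t ∈ Ioo (-ε) ε) :
    ContinuousAt (fun t => cometric g (γ t) (P t)) t :=
  ((hg.contDiffAt_cometric (h.mem t ht)).continuousAt.comp
    (h.hasDerivAt_position t ht).continuousAt).clm_apply (h.hasDerivAt_momentum t ht).continuousAt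

theorem continuousAt_force : ContinuousAt (fun t => force g (γ t, P t)) 0 := by
  have h0 := h.zero_mem
  have h1 : ContinuousAt (fderiv ℝ (hamiltonian g)) (γ 0, P 0) :=
    ((hg.contDiffAt_hamiltonian (h.mem 0 h0) (P 0)).fderiv_right (m := 1)
      (by norm_num)).continuousAt
  have h2 : ContinuousAt (fun t => (γ t, P t)) 0 :=
    (h.hasDerivAt_position 0 h0).continuousAt.prodMk (h.hasDerivAt_momentum 0 h0).continuousAt
  have h3 : ContinuousAt (fun t => fderiv ℝ (hamiltonian g) (γ t, P t)) 0 :=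
    ContinuousAt.comp (g := fderiv ℝ (hamiltonian g)) (f := fun t => (γ t, P t)) h1 h2
  exact (continuousAt_const (y := (-(1 / 2) : ℝ))).smul (h3.clm_comp
    (continuousAt_const (y := ContinuousLinearMap.inl ℝ (EuclideanSpace ℝ (Fin n)) _)))

theorem contDiffOn : ContDiffOn ℝ 1 γ (Ioo (-ε) ε) := by
  rw [show (1 : WithTop ℕ∞) = 0 + 1 from (zero_add 1).symm,
    contDiffOn_succ_iff_deriv_of_isOpen isOpen_Ioo]
  refine ⟨fun t ht => (h.hasDerivAt_position t ht).differentiableAt.differentiableWithinAt,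
    by simp, ?_⟩
  rw [contDiffOn_zero]
  refine ContinuousOn.congr (f := fun t => cometric g (γ t) (P t))
    (fun t ht => (h.continuousAt_velocity hg ht).continuousWithinAt)
    fun t ht => (h.hasDerivAt_position t ht).deriv

/-- The time at which the curve crosses the level hypersurface of `P 0` through a given point. -/
theorem exists_time :
    ∃ τ : EuclideanSpace ℝ (Fin n) → ℝ, (∀ᶠ t in 𝓝 0, τ (γ t) = t) ∧
      ∀ᶠ x in 𝓝 (γ 0), HasFDerivAt τ ((P 0 (cometric g (γ (τ x)) (P (τ x))))⁻¹ • P 0) x := by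
  have hψ : ∀ᶠ t in 𝓝 (0 : ℝ), HasDerivAt (fun t => P 0 (γ t))
      (P 0 (cometric g (γ t) (P t))) t := by
    filter_upwards [h.mem_nhds] with t ht
    exact (P 0).hasFDerivAt.comp_hasDerivAt t (h.hasDerivAt_position t ht)
  obtain ⟨φ, hφ1, hφ2⟩ := exists_local_inverse hψ
    ((P 0).continuous.continuousAt.comp (h.continuousAt_velocity hg h.zero_mem))
    (h.energy 0 h.zero_mem)
  refine ⟨fun x => φ (P 0 x), hφ1, ?_⟩
  filter_upwards [(P 0).continuous.continuousAt.eventually hφ2] with x hx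
  exact hx.comp_hasFDerivAt x (P 0).hasFDerivAt

/-- Near each of its points, the curve is calibrated by a function whose differential has norm at
most one. -/
theorem exists_calibration :
    ∃ f : EuclideanSpace ℝ (Fin n) → ℝ, (∀ᶠ t in 𝓝 0, f (γ t) = t) ∧
      ∀ᶠ x in 𝓝 (γ 0), DifferentiableAt ℝ f x ∧
        ∀ w, fderiv ℝ f x w ≤ Real.sqrt (metricForm g x w w) := by
  obtain ⟨τ, hτ1, hτ2⟩ := h.exists_time hg
  have h0 := h.zero_mem
  have hτ0 : τ (γ 0) = 0 := hτ1.self_of_nhds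
  have hτc : Tendsto τ (𝓝 (γ 0)) (𝓝 0) := by
    have := hτ2.self_of_nhds.continuousAt.tendsto
    rwa [hτ0] at this
  have hγc : ContinuousAt γ 0 := (h.hasDerivAt_position 0 h0).continuousAt
  have hPc : ContinuousAt P 0 := (h.hasDerivAt_momentum 0 h0).continuousAt
  have hvc := h.continuousAt_velocity hg h0
  have hqc := h.continuousAt_force hg
  obtain ⟨C, hC, r, hr, hTaylor⟩ :=
    exists_taylor_bound (hg.contDiffAt_hamiltonian (h.mem 0 h0) (P 0))
  -- B bounds the velocity, the force and the differential of τ near time 0. The summand 2‖P 0‖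
  -- serves the last one, whose factor (P 0 v)⁻¹ is kept below 2.
  set B := ‖cometric g (γ 0) (P 0)‖ + ‖force g (γ 0, P 0)‖ + 2 * ‖P 0‖ + 1 with hB
  have hB0 : 0 < B := by positivity
  set C₁ := 1 + 2 * B ^ 2 + B with hC₁
  have hC₁0 : 1 ≤ C₁ := by nlinarith [sq_nonneg B]
  -- The Taylor error will be at most C(C₁‖y‖)², and K is chosen to beat it. There is no
  -- circularity: the neighbourhood is shrunk so that K|t| ≤ 1 and K‖y‖ ≤ 1, which makes C₁
  -- independent of K.
  set K := C * C₁ ^ 2 + 1 with hK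
  have hK0 : 0 < K := by positivity
  have hcross : Tendsto (fun x => ‖x - γ (τ x)‖) (𝓝 (γ 0)) (𝓝 0) := by
    have h1 : Tendsto (fun x => x - γ (τ x)) (𝓝 (γ 0)) (𝓝 (γ 0 - γ 0)) :=
      tendsto_id.sub (hγc.tendsto.comp hτc)
    rw [sub_self] at h1
    simpa using h1.norm
  have ev1 : ∀ᶠ t in 𝓝 (0 : ℝ), t ∈ Ioo (-ε) ε ∧ ‖cometric g (γ t) (P t)‖ < B ∧
      ‖force g (γ t, P t)‖ < B ∧ 1 / 2 < P 0 (cometric g (γ t) (P t)) ∧ K * |t| ≤ 1 ∧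
      (γ t, P t) ∈ Metric.ball (γ 0, P 0) r ∧ P t ∈ Metric.ball (P 0) (r / 2) := by
    refine Filter.Eventually.and h.mem_nhds (.and ?_ (.and ?_ (.and ?_ (.and ?_ (.and ?_ ?_)))))
    · refine hvc.norm.eventually_lt continuousAt_const ?_
      have := norm_nonneg (force g (γ 0, P 0))
      have := norm_nonneg (P 0)
      simp only [hB]; linarith
    · refine hqc.norm.eventually_lt continuousAt_const ?_
      have := norm_nonneg (cometric g (γ 0) (P 0))
      have := norm_nonneg (P 0)
      simp only [hB]; linarith
    · refine continuousAt_const.eventually_lt ((P 0).continuous.continuousAt.comp hvc) ?_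
      have := h.energy 0 h0
      simp only [this]; norm_num
    · have : ContinuousAt (fun t : ℝ => K * |t|) 0 := by fun_prop
      refine (this.eventually_lt (continuousAt_const (y := (1 : ℝ))) (by simp)).mono
        fun t ht => ht.le
    · exact (hγc.prodMk hPc).eventually (Metric.ball_mem_nhds _ hr)
    · exact hPc.eventually (Metric.ball_mem_nhds _ (half_pos hr))
  have ev2 : ∀ᶠ x in 𝓝 (γ 0), K * ‖x - γ (τ x)‖ < 1 ∧ C₁ * ‖x - γ (τ x)‖ < r / 2 := by
    have h1 := hcross.const_mul K
    have h2 := hcross.const_mul C₁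
    rw [mul_zero] at h1 h2
    exact (h1.eventually_lt_const one_pos).and (h2.eventually_lt_const (half_pos hr))
  have hxU : ∀ᶠ x in 𝓝 (γ 0), x ∈ U := hg.isOpen.mem_nhds (h.mem 0 h0)
  have hxr : ∀ᶠ x in 𝓝 (γ 0), x ∈ Metric.ball (γ 0) r := Metric.ball_mem_nhds _ hr
  -- Along γ the displacement y vanishes, so f(γ(t)) = t. The affine part alone gives |df|² = 1 up
  -- to an error of order ‖y‖², of uncontrolled sign; the last term lowers |df|² by K‖y‖² and
  -- absorbs it.
  refine ⟨fun x => τ x + P (τ x) (x - γ (τ x)) - K / 2 * (τ x * ‖x - γ (τ x)‖ ^ 2), ?_, ?_⟩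
  · filter_upwards [hτ1] with t ht
    simp [ht]
  · filter_upwards [hτ2, hτc.eventually ev1, ev2, hxU, hxr] with x hx1 hx2 hx3 hx4 hx5
    obtain ⟨ht, hv, hq, hhalf, hKt, hball, hPball⟩ := hx2
    have hderiv := hasFDerivAt_calibration K hx1 (h.hasDerivAt_position _ ht)
      (h.hasDerivAt_momentum _ ht) (h.energy _ ht)
    refine ⟨hderiv.differentiableAt, fun w => ?_⟩
    rw [hderiv.fderiv]
    set t := τ x with htdef
    set y := x - γ t with hy
    set v := cometric g (γ t) (P t) with hvdef
    set q := force g (γ t, P t) with hqdef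
    set a := q y - K / 2 * ‖y‖ ^ 2 + K * t * inner ℝ y v with ha
    set τ' := (P 0 v)⁻¹ • P 0 with hτ'
    set δ := a • τ' - (K * t) • innerSL ℝ y with hδ
    have hτ'v : τ' v = 1 := by
      rw [hτ', smul_apply, smul_eq_mul, inv_mul_cancel₀]
      linarith
    have hτ'n : ‖τ'‖ ≤ B := by
      rw [hτ', norm_smul, norm_inv, Real.norm_eq_abs, abs_of_pos (by linarith)]
      have h1 : (P 0 v)⁻¹ ≤ 2 := by
        rw [inv_le_comm₀ (by linarith) (by norm_num)]; linarith
      have h2 := mul_le_mul_of_nonneg_right h1 (norm_nonneg (P 0))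
      have h3 := norm_nonneg (cometric g (γ 0) (P 0))
      have h4 := norm_nonneg (force g (γ 0, P 0))
      simp only [hB]; linarith
    have hyn := norm_nonneg y
    have hδn : ‖δ‖ ≤ C₁ * ‖y‖ :=
      norm_calibration_correction_le hB0.le hK0.le hq.le hv.le hτ'n hKt hx3.1.le
    have hz' : (x, P t + δ) ∈ Metric.ball (γ 0, P 0) r := by
      rw [← ball_prod_same]
      refine ⟨hx5, ?_⟩
      rw [mem_ball_iff_norm] at hPball ⊢
      calc ‖P t + δ - P 0‖ = ‖(P t - P 0) + δ‖ := by congr 1; abel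
        _ ≤ ‖P t - P 0‖ + ‖δ‖ := norm_add_le _ _
        _ < r := by linarith [hx3.2]
    have hT := hTaylor _ hball _ hz'
    have hdiff : (x, P t + δ) - (γ t, P t) = (y, δ) := by
      rw [Prod.mk_sub_mk, add_sub_cancel_left]
    -- The position derivative contributes -2q(y) by the momentum equation and the momentum
    -- derivative contributes 2δ(v) = 2q(y) - K‖y‖². The terms linear in y cancel.
    have hlin : fderiv ℝ (hamiltonian g) (γ t, P t) (y, δ) = -(K * ‖y‖ ^ 2) := by
      have h1 := hg.force_apply (h.mem t ht) (P t) y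
      rw [hg.fderiv_hamiltonian (h.mem t ht)]
      have h2 : δ v = q y - K / 2 * ‖y‖ ^ 2 := by
        simp only [hδ, sub_apply, smul_apply, smul_eq_mul, hτ'v, innerSL_apply_apply, ha]
        ring
      rw [← hvdef, h2]
      rw [← hqdef] at h1
      linarith
    rw [hdiff, hlin] at hT
    have hnorm : ‖(y, δ)‖ ≤ C₁ * ‖y‖ := by
      rw [Prod.norm_mk]
      exact max_le (le_mul_of_one_le_left hyn hC₁0) hδn
    have hH0 : hamiltonian g (γ t, P t) = 1 := h.energy t ht
    have hH1 : (P t + δ) (cometric g x (P t + δ)) ≤ 1 := by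
      have h1 : hamiltonian g (x, P t + δ) ≤ 1 - K * ‖y‖ ^ 2 + C * (C₁ * ‖y‖) ^ 2 := by
        have h2 := (abs_le.mp hT).2
        have h3 : C * ‖(y, δ)‖ ^ 2 ≤ C * (C₁ * ‖y‖) ^ 2 :=
          mul_le_mul_of_nonneg_left (pow_le_pow_left₀ (norm_nonneg _) hnorm 2) hC
        rw [hH0] at h2
        linarith
      refine h1.trans ?_
      have h2 : C * (C₁ * ‖y‖) ^ 2 = K * ‖y‖ ^ 2 - ‖y‖ ^ 2 := by rw [hK]; ring
      rw [h2]
      linarith only [sq_nonneg ‖y‖]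
    have hfin := hg.abs_apply_le hx4 (P t + δ) w
    refine (le_abs_self _).trans (hfin.trans ?_)
    refine mul_le_of_le_one_left (Real.sqrt_nonneg _) ?_
    exact Real.sqrt_le_one.mpr hH1

end IsHamiltonCurve

/-! ### Local minimality of hamiltonian curves, and the dissipation along them. -/

namespace IsHamiltonCurve

variable {n : ℕ} {U : Set (EuclideanSpace ℝ (Fin n))}
  {g : EuclideanSpace ℝ (Fin n) → Matrix (Fin n) (Fin n) ℝ} {γ : ℝ → EuclideanSpace ℝ (Fin n)}
  {P : ℝ → EuclideanSpace ℝ (Fin n) →L[ℝ] ℝ} {ε : ℝ} (h : IsHamiltonCurve U g γ P ε)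
  (hg : IsRiemannianMetric U g)
include h hg

theorem quadForm_deriv {t : ℝ} (ht : t ∈ Ioo (-ε) ε) : quadForm g (γ t) (deriv γ t) = 1 := by
  rw [quadForm_eq, (h.hasDerivAt_position t ht).deriv, hg.metricForm_cometric (h.mem t ht),
    h.energy t ht]

theorem length_eq {s t : ℝ} (hs : s ∈ Ioo (-ε) ε) (ht : t ∈ Ioo (-ε) ε) (hst : s ≤ t) :
    length g γ s t = t - s := by
  have h1 : ∀ u ∈ uIcc s t, Real.sqrt (quadForm g (γ u) (deriv γ u)) = 1 := by
    intro u hu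
    rw [uIcc_of_le hst] at hu
    rw [h.quadForm_deriv hg ⟨hs.1.trans_le hu.1, hu.2.trans_lt ht.2⟩, Real.sqrt_one]
  rw [length, intervalIntegral.integral_congr h1]
  simp

/-- Solutions of the geodesic equations are locally minimizing. -/
theorem exists_isGeodesic :
    ∃ η > 0, η < ε ∧ IsGeodesic U g γ (-η) η ∧ IsUnitary g γ (-η) η := by
  have h0 := h.zero_mem
  obtain ⟨f, hf1, hf2⟩ := h.exists_calibration hg
  obtain ⟨k, hk, ρ₁, hρ₁, -, hk2⟩ := hg.exists_mul_norm_le (h.mem 0 h0)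
  obtain ⟨ρ₂, hρ₂, hball⟩ := Metric.nhds_basis_closedBall.eventually_iff.mp hf2
  set ρ := min ρ₁ ρ₂ with hρ
  have hρ0 : 0 < ρ := lt_min hρ₁ hρ₂
  have ev : ∀ᶠ t in 𝓝 (0 : ℝ), t ∈ Ioo (-ε) ε ∧ f (γ t) = t ∧ ‖γ t - γ 0‖ < ρ / 2 := by
    refine Filter.Eventually.and h.mem_nhds (hf1.and ?_)
    have h1 : ContinuousAt (fun t => ‖γ t - γ 0‖) 0 :=
      ((h.hasDerivAt_position 0 h0).continuousAt.sub continuousAt_const).norm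
    exact h1.eventually_lt continuousAt_const (by simpa using half_pos hρ0)
  obtain ⟨r, hr, hev⟩ := Metric.nhds_basis_ball.eventually_iff.mp ev
  -- The second bound makes the length 2η of the arc at most k(ρ/2), the least length of a curve
  -- that starts within ρ/2 of γ(0) and leaves the ball of radius ρ.
  set η := min (r / 2) (k * (ρ / 4)) with hη
  have hη0 : 0 < η := by positivity
  have hηr : η ≤ r / 2 := min_le_left _ _
  have hηk : η ≤ k * (ρ / 4) := min_le_right _ _
  have hev' : ∀ t ∈ Icc (-η) η, t ∈ Ioo (-ε) ε ∧ f (γ t) = t ∧ ‖γ t - γ 0‖ < ρ / 2 := by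
    intro t ht
    refine hev ?_
    rw [mem_ball_zero_iff, Real.norm_eq_abs, abs_lt]
    constructor <;> linarith [ht.1, ht.2]
  have hle : -η ≤ η := by linarith
  have hl := hev' (-η) (left_mem_Icc.mpr hle)
  have hr := hev' η (right_mem_Icc.mpr hle)
  refine ⟨η, hη0, hr.1.2, ⟨⟨hle, (h.contDiffOn hg).mono fun t ht => (hev' t ht).1,
    fun t ht => h.mem t (hev' t ht).1, rfl, rfl⟩, ?_⟩,
    fun t ht => h.quadForm_deriv hg (hev' t (Ioo_subset_Icc_self ht)).1⟩
  intro c a b hc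
  rw [h.length_eq hg hl.1 hr.1 hle]
  -- A competitor that leaves the ball is too long. One that stays inside is compared by means of f,
  -- whose increment between the end points is 2η.
  by_cases hexit : ∃ t ∈ Icc a b, ρ ≤ ‖c t - γ 0‖
  · obtain ⟨t, ht, hge⟩ := hexit
    have h1 := hg.mul_le_length_of_exit hk
      (fun x hx => hk2 x (Metric.closedBall_subset_closedBall (min_le_left _ _) hx))
      hc.contDiffOn hc.mapsTo (by rw [hc.source]; exact hl.2.2.le) ht hge
    linarith
  · push Not at hexit
    have hmem : ∀ t ∈ Icc a b, c t ∈ Metric.closedBall (γ 0) ρ₂ := by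
      intro t ht
      rw [mem_closedBall_iff_norm]
      exact (hexit t ht).le.trans (min_le_right _ _)
    have h1 := hg.sub_le_length hc.le hc.contDiffOn hc.mapsTo (f := f) (f' := fderiv ℝ f)
      (fun t ht => (hball (hmem t ht)).1.hasFDerivAt) (fun t ht => (hball (hmem t ht)).2)
    rwa [hc.source, hc.target, hl.2.1, hr.2.1] at h1

theorem hasDerivAt_potential {S : EuclideanSpace ℝ (Fin n) → ℝ} (hS : ContDiffOn ℝ 2 S U)
    {t : ℝ} (ht : t ∈ Ioo (-ε) ε) :
    HasDerivAt (fun s => S (γ s)) (fderiv ℝ S (γ t) (cometric g (γ t) (P t))) t :=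
  ((((hS _ (h.mem t ht)).contDiffAt (hg.isOpen.mem_nhds (h.mem t ht))).differentiableAt
    (by simp)).hasFDerivAt).comp_hasDerivAt t (h.hasDerivAt_position t ht)

/-- The derivative of the dissipation along a solution of the geodesic equations. -/
theorem hasDerivAt_dissipation {S : EuclideanSpace ℝ (Fin n) → ℝ} (hS : ContDiffOn ℝ 2 S U) :
    HasDerivAt (dissipation S γ)
      (fderiv ℝ (fderiv ℝ S) (γ 0) (cometric g (γ 0) (P 0)) (cometric g (γ 0) (P 0))
        + fderiv ℝ S (γ 0)
            (fderiv ℝ (cometric g) (γ 0) (cometric g (γ 0) (P 0)) (P 0))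
        - 1 / 2 * P 0 (fderiv ℝ (cometric g) (γ 0)
            (cometric g (γ 0) (fderiv ℝ S (γ 0))) (P 0))) 0 := by
  have h0 := h.zero_mem
  have hx := h.mem 0 h0
  have hγ := h.hasDerivAt_position 0 h0
  have hP := h.hasDerivAt_momentum 0 h0
  have hSx : ContDiffAt ℝ 2 S (γ 0) := (hS _ hx).contDiffAt (hg.isOpen.mem_nhds hx)
  have h1 : HasDerivAt (fun t => fderiv ℝ S (γ t))
      (fderiv ℝ (fderiv ℝ S) (γ 0) (cometric g (γ 0) (P 0))) 0 :=
    (((hSx.fderiv_right (m := 1) (by norm_num)).differentiableAt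
      (by simp)).hasFDerivAt).comp_hasDerivAt 0 hγ
  have h2 : HasDerivAt (fun t => cometric g (γ t))
      (fderiv ℝ (cometric g) (γ 0) (cometric g (γ 0) (P 0))) 0 :=
    ((hg.contDiffAt_cometric hx).differentiableAt (by simp)).hasFDerivAt.comp_hasDerivAt 0 hγ
  have h3 := (h1.clm_apply (h2.clm_apply hP)).congr_of_eventuallyEq (f₁ := dissipation S γ) (by
    filter_upwards [h.mem_nhds] with t ht
    exact (h.hasDerivAt_potential hg hS ht).deriv)
  refine h3.congr_deriv ?_
  rw [map_add, hg.cometric_symm hx (fderiv ℝ S (γ 0)), hg.force_apply hx]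
  ring

end IsHamiltonCurve

/-! ### The Hessian identity and the conserved quantity. -/

namespace IsFluctuationGeometry

variable {n : ℕ} {U : Set (EuclideanSpace ℝ (Fin n))}
  {g : EuclideanSpace ℝ (Fin n) → Matrix (Fin n) (Fin n) ℝ}
  {S : EuclideanSpace ℝ (Fin n) → ℝ} {p : Measure (EuclideanSpace ℝ (Fin n))}
  (h : IsFluctuationGeometry U g S p)
include h

theorem contDiffAt_potential {x : EuclideanSpace ℝ (Fin n)} (hx : x ∈ U) : ContDiffAt ℝ 2 S x :=
  (h.potential_contDiffOn x hx).contDiffAt (h.isOpen.mem_nhds hx)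

theorem differentiableAt_fderiv {x : EuclideanSpace ℝ (Fin n)} (hx : x ∈ U) :
    DifferentiableAt ℝ (fderiv ℝ S) x :=
  ((h.contDiffAt_potential hx).fderiv_right (m := 1) (by norm_num)).differentiableAt (by simp)

/-- The covariant Hessian of the potential is the opposite of the metric, as an identity between
quadratic forms on unit covectors. -/
theorem hessian_of_unit {x : EuclideanSpace ℝ (Fin n)} (hx : x ∈ U)
    {q : EuclideanSpace ℝ (Fin n) →L[ℝ] ℝ} (hq : q (cometric g x q) = 1) :
    fderiv ℝ (fderiv ℝ S) x (cometric g x q) (cometric g x q)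
      + fderiv ℝ S x (fderiv ℝ (cometric g) x (cometric g x q) q)
      - 1 / 2 * q (fderiv ℝ (cometric g) x (cometric g x (fderiv ℝ S x)) q) = -1 := by
  have hg := h.isRiemannianMetric
  obtain ⟨γ, P, ε, hγ, rfl, rfl⟩ := hg.exists_isHamiltonCurve hx hq
  obtain ⟨η, hη, hηε, hgeo, hunit⟩ := hγ.exists_isGeodesic hg
  -- Hypothesis 2 makes the dissipation affine of slope -1 on the minimizing arc, which gives a
  -- second value for its derivative at 0.
  refine (hγ.hasDerivAt_dissipation hg h.potential_contDiffOn).unique ?_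
  have hmem : ∀ t ∈ Ioo (-η) η, t ∈ Ioo (-ε) ε := fun t ht =>
    ⟨by linarith [ht.1], by linarith [ht.2]⟩
  have hlin : ∀ s ∈ Ioo (-η) η, ∀ t ∈ Ioo (-η) η, s < t →
      dissipation S γ s - dissipation S γ t = t - s := fun s hs t ht hst => by
    rw [← h.length_eq_dissipation γ (-η) η hgeo hunit s t hs.1 hst ht.2,
      hγ.length_eq hg (hmem s hs) (hmem t ht) hst.le]
  have h0 : (0 : ℝ) ∈ Ioo (-η) η := ⟨by linarith, hη⟩
  have h1 : HasDerivAt (fun t : ℝ => dissipation S γ 0 - t) (-1) 0 :=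
    (hasDerivAt_id (0 : ℝ)).const_sub _
  refine h1.congr_of_eventuallyEq ?_
  filter_upwards [Ioo_mem_nhds h0.1 h0.2] with t ht
  rcases lt_trichotomy t 0 with h2 | h2 | h2
  · linarith [hlin t ht 0 h0 h2]
  · simp [h2]
  · linarith [hlin 0 h0 t ht h2]

/-- Both sides are homogeneous of degree two in q, so the case of unit covectors suffices. -/
theorem hessian_quadratic {x : EuclideanSpace ℝ (Fin n)} (hx : x ∈ U)
    (q : EuclideanSpace ℝ (Fin n) →L[ℝ] ℝ) :
    fderiv ℝ (fderiv ℝ S) x (cometric g x q) (cometric g x q)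
      + fderiv ℝ S x (fderiv ℝ (cometric g) x (cometric g x q) q)
      - 1 / 2 * q (fderiv ℝ (cometric g) x (cometric g x (fderiv ℝ S x)) q)
      = -q (cometric g x q) := by
  have hg := h.isRiemannianMetric
  rcases eq_or_ne (q (cometric g x q)) 0 with hz | hz
  · rw [hg.cometric_eq_zero hx hz]; simp
  have hpos : 0 < q (cometric g x q) := lt_of_le_of_ne (hg.cometric_nonneg hx q) hz.symm
  set s := Real.sqrt (q (cometric g x q)) with hs
  have hs0 : 0 < s := Real.sqrt_pos.mpr hpos
  have hsq : s ^ 2 = q (cometric g x q) := Real.sq_sqrt hpos.le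
  have h1 := h.hessian_of_unit hx (q := s⁻¹ • q) (by
    simp only [map_smul, smul_apply, smul_eq_mul, ← hsq]
    field_simp)
  simp only [map_smul, smul_apply, smul_eq_mul] at h1
  rw [← hsq]
  field_simp at h1
  linarith

theorem fderiv_cometric_symm {x : EuclideanSpace ℝ (Fin n)} (hx : x ∈ U)
    (w : EuclideanSpace ℝ (Fin n)) (q r : EuclideanSpace ℝ (Fin n) →L[ℝ] ℝ) :
    q (fderiv ℝ (cometric g) x w r) = r (fderiv ℝ (cometric g) x w q) := by
  have hg := h.isRiemannianMetric
  have hG := ((hg.contDiffAt_cometric hx).differentiableAt (by simp)).hasFDerivAt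
  have h1 : ∀ q r : EuclideanSpace ℝ (Fin n) →L[ℝ] ℝ, HasFDerivAt (fun y => q (cometric g y r))
      (q.comp ((fderiv ℝ (cometric g) x).flip r)) x := by
    intro q r
    refine (q.hasFDerivAt.comp x (hG.clm_apply (hasFDerivAt_const r x))).congr_fderiv ?_
    ext v; simp
  have h2 := (h1 q r).congr_of_eventuallyEq (f₁ := fun y => r (cometric g y q)) (by
    filter_upwards [h.isOpen.mem_nhds hx] with y hy
    exact hg.cometric_symm hy r q)
  have h3 := h2.unique (h1 r q)
  simpa using congrArg (fun f : EuclideanSpace ℝ (Fin n) →L[ℝ] ℝ => f w) h3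

/-- Polarization of `hessian_quadratic` between q and dS. Two of the terms with a derivative of the
inverse metric cancel by its symmetry, and what remains on the left is half the differential of
|∇S|². -/
theorem hessian_gradient {x : EuclideanSpace ℝ (Fin n)} (hx : x ∈ U)
    (w : EuclideanSpace ℝ (Fin n)) :
    fderiv ℝ (fderiv ℝ S) x w (cometric g x (fderiv ℝ S x))
      + 1 / 2 * fderiv ℝ S x (fderiv ℝ (cometric g) x w (fderiv ℝ S x)) = -fderiv ℝ S x w := by
  have hg := h.isRiemannianMetric
  set d := fderiv ℝ S x with hd
  obtain ⟨q, rfl⟩ : ∃ q, cometric g x q = w := ⟨_, hg.cometric_metricForm hx w⟩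
  have h1 := h.hessian_quadratic hx (q + d)
  have h2 := h.hessian_quadratic hx (q - d)
  have hsymm := ((h.contDiffAt_potential hx).isSymmSndFDerivAt (by simp)).eq
    (cometric g x q) (cometric g x d)
  have h3 := h.fderiv_cometric_symm hx (cometric g x d) q d
  have h4 := hg.cometric_symm hx q d
  simp only [← hd, map_add, map_sub, add_apply, sub_apply] at h1 h2
  linarith

/-- The squared norm of the gradient of the potential, plus twice the potential, is constant. -/
theorem exists_energy_const :
    ∃ M, ∀ x ∈ U, fderiv ℝ S x (cometric g x (fderiv ℝ S x)) = 2 * (M - S x) := by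
  have hg := h.isRiemannianMetric
  have hderiv : ∀ x ∈ U, HasFDerivAt
      (fun y => fderiv ℝ S y (cometric g y (fderiv ℝ S y)) + 2 * S y)
      (0 : EuclideanSpace ℝ (Fin n) →L[ℝ] ℝ) x := by
    intro x hx
    have h1 := (h.differentiableAt_fderiv hx).hasFDerivAt
    have h2 := ((hg.contDiffAt_cometric hx).differentiableAt (by simp)).hasFDerivAt
    have h3 := ((h.contDiffAt_potential hx).differentiableAt (by simp)).hasFDerivAt
    refine ((h1.clm_apply (h2.clm_apply h1)).add (h3.const_mul 2)).congr_fderiv ?_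
    ext w
    have h4 := h.hessian_gradient hx w
    have h5 := hg.cometric_symm hx (fderiv ℝ S x) (fderiv ℝ (fderiv ℝ S) x w)
    simp [h5]
    linarith
  obtain ⟨a, ha⟩ := h.isOpen.exists_is_const_of_fderiv_eq_zero h.isConnected.isPreconnected
    (fun x hx => (hderiv x hx).differentiableAt.differentiableWithinAt)
    (fun x hx => (hderiv x hx).fderiv)
  exact ⟨a / 2, fun x hx => by linarith [ha x hx]⟩

end IsFluctuationGeometry

/-! ### Existence of a maximum, the eikonal equation and its first consequences. -/

namespace IsFluctuationGeometry

variable {n : ℕ} {U : Set (EuclideanSpace ℝ (Fin n))}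
  {g : EuclideanSpace ℝ (Fin n) → Matrix (Fin n) (Fin n) ℝ}
  {S : EuclideanSpace ℝ (Fin n) → ℝ} {p : Measure (EuclideanSpace ℝ (Fin n))}
  (h : IsFluctuationGeometry U g S p)
include h

/-- The superlevel sets of the potential are compact. -/
theorem isCompact_superlevel (c : ℝ) : IsCompact {x | x ∈ U ∧ c ≤ S x} := by
  refine Metric.isCompact_of_isClosed_isBounded ?_ ?_
  · refine isClosed_of_closure_subset fun x hx => ?_
    have hfreq : ∃ᶠ y in 𝓝[U] x, c ≤ S y := by
      rw [frequently_nhdsWithin_iff]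
      exact (mem_closure_iff_frequently.mp hx).mono fun y hy => ⟨hy.2, hy.1⟩
    by_cases hxU : x ∈ U
    · refine ⟨hxU, ?_⟩
      by_contra hlt
      have hS := (h.contDiffAt_potential hxU).continuousAt.continuousWithinAt (s := U)
      exact hfreq ((hS.eventually_lt continuousWithinAt_const (not_le.mp hlt)).mono
        fun y hy => not_le.mpr hy)
    · have hfr : x ∈ frontier U := by
        rw [h.isOpen.frontier_eq]
        exact ⟨closure_mono (fun y hy => hy.1) hx, hxU⟩
      have hlim := h.weight_tendsto_frontier x hfr
      exact absurd ((hlim.eventually_lt_const (Real.exp_pos c)).mono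
        fun y hy => not_le.mpr (Real.exp_lt_exp.mp hy)) hfreq
  · have hev := h.weight_tendsto_infinity.eventually_lt_const (Real.exp_pos c)
    rw [eventually_inf_principal] at hev
    rw [Bornology.isBounded_def]
    filter_upwards [hev] with y hy hmem
    exact absurd hmem.2 (not_le.mpr (Real.exp_lt_exp.mp (hy hmem.1)))

theorem continuousOn_potential : ContinuousOn S U := h.potential_contDiffOn.continuousOn

theorem exists_isMaxOn : ∃ x ∈ U, IsMaxOn S U x := by
  obtain ⟨x₀, hx₀⟩ := h.isConnected.nonempty
  obtain ⟨x, hx, hmax⟩ := (h.isCompact_superlevel (S x₀)).exists_isMaxOn ⟨x₀, hx₀, le_rfl⟩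
    (h.continuousOn_potential.mono fun y hy => hy.1)
  refine ⟨x, hx.1, fun y hy => ?_⟩
  rcases le_total (S x₀) (S y) with hle | hle
  · exact hmax ⟨hy, hle⟩
  · exact hle.trans hx.2

theorem fderiv_eq_zero_of_isMaxOn {m : EuclideanSpace ℝ (Fin n)} (hm : m ∈ U)
    (hmax : IsMaxOn S U m) : fderiv ℝ S m = 0 :=
  (hmax.isLocalMax (h.isOpen.mem_nhds hm)).fderiv_eq_zero

/-- The eikonal equation of the potential. -/
theorem eikonal {m : EuclideanSpace ℝ (Fin n)} (hm : m ∈ U) (hmax : IsMaxOn S U m)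
    {x : EuclideanSpace ℝ (Fin n)} (hx : x ∈ U) :
    fderiv ℝ S x (cometric g x (fderiv ℝ S x)) = 2 * (S m - S x) := by
  obtain ⟨M, hM⟩ := h.exists_energy_const
  have h1 := hM m hm
  rw [h.fderiv_eq_zero_of_isMaxOn hm hmax] at h1
  simp only [map_zero] at h1
  rw [hM x hx]
  linarith

theorem eq_of_fderiv_eq_zero {m : EuclideanSpace ℝ (Fin n)} (hm : m ∈ U) (hmax : IsMaxOn S U m)
    {x : EuclideanSpace ℝ (Fin n)} (hx : x ∈ U) (h0 : fderiv ℝ S x = 0) : S x = S m := by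
  have h1 := h.eikonal hm hmax hx
  rw [h0] at h1
  simp only [map_zero] at h1
  linarith

/-- A curve ending at a maximum is at least as long as the depth of its starting point. -/
theorem sqrt_le_length {m : EuclideanSpace ℝ (Fin n)} (hm : m ∈ U) (hmax : IsMaxOn S U m)
    {c : ℝ → EuclideanSpace ℝ (Fin n)} {a b : ℝ} {x : EuclideanSpace ℝ (Fin n)}
    (hc : IsCurve U c a b x m) : Real.sqrt (2 * (S m - S x)) ≤ length g c a b := by
  have hg := h.isRiemannianMetric
  refine le_of_forall_pos_le_add fun δ hδ => ?_
  -- The square root of the depth need not be differentiable where the depth vanishes. Adding δ²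
  -- makes it so and keeps its gradient of norm at most one, at the cost of an error δ.
  set r : EuclideanSpace ℝ (Fin n) → ℝ := fun y => Real.sqrt (2 * (S m - S y) + δ ^ 2) with hr
  have hpos : ∀ y ∈ U, 0 < 2 * (S m - S y) + δ ^ 2 := fun y hy => by
    have : S y ≤ S m := hmax hy
    have : 0 < δ ^ 2 := by positivity
    linarith
  have hd : ∀ y ∈ U, HasFDerivAt (fun y => -r y) ((r y)⁻¹ • fderiv ℝ S y) y := by
    intro y hy
    have h1 := ((h.contDiffAt_potential hy).differentiableAt (by simp)).hasFDerivAt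
    have h2 := ((((h1.const_sub (S m)).const_mul 2).add_const (δ ^ 2)).sqrt (hpos y hy).ne').neg
    refine h2.congr_fderiv ?_
    ext w
    simp [hr]
    ring
  have h1 := hg.sub_le_length hc.le hc.contDiffOn hc.mapsTo
    (f' := fun y => (r y)⁻¹ • fderiv ℝ S y) (fun t ht => hd _ (hc.mapsTo ht)) fun t ht w => by
      have hy := hc.mapsTo ht
      have h2 := (le_abs_self _).trans (hg.abs_apply_le hy (fderiv ℝ S (c t)) w)
      rw [h.eikonal hm hmax hy] at h2
      have h3 : Real.sqrt (2 * (S m - S (c t))) ≤ r (c t) :=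
        Real.sqrt_le_sqrt (by linarith [sq_nonneg δ])
      rw [smul_apply, smul_eq_mul, inv_mul_le_iff₀ (Real.sqrt_pos.mpr (hpos _ hy))]
      exact h2.trans (mul_le_mul_of_nonneg_right h3 (Real.sqrt_nonneg _))
  rw [hc.source, hc.target] at h1
  have h2 : r m = δ := by simp [hr, Real.sqrt_sq hδ.le]
  have h3 : Real.sqrt (2 * (S m - S x)) ≤ r x := Real.sqrt_le_sqrt (by linarith [sq_nonneg δ])
  rw [h2] at h1
  linarith

/-- Maxima of the potential are isolated critical points. -/
theorem eventually_fderiv_ne_zero {m : EuclideanSpace ℝ (Fin n)} (hm : m ∈ U)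
    (hmax : IsMaxOn S U m) : ∀ᶠ x in 𝓝[≠] m, fderiv ℝ S x ≠ 0 := by
  have hg := h.isRiemannianMetric
  have h0 := h.fderiv_eq_zero_of_isMaxOn hm hmax
  refine (h.differentiableAt_fderiv hm).hasFDerivAt.eventually_ne ?_
  -- At m the terms containing dS vanish, so the ordinary Hessian is -g there and is nondegenerate.
  have hker : (fderiv ℝ (fderiv ℝ S) m).toLinearMap.ker = ⊥ := by
    rw [LinearMap.ker_eq_bot']
    intro w hw
    by_contra hne
    have h1 := h.hessian_quadratic hm (metricForm g m w)
    rw [hg.cometric_metricForm hm, h0] at h1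
    have h2 : fderiv ℝ (fderiv ℝ S) m w = 0 := hw
    have h3 := hg.metricForm_pos hm hne
    simp [h2] at h1
    linarith
  obtain ⟨K, -, hK⟩ := LinearMap.exists_antilipschitzWith _ hker
  exact ⟨K, hK⟩

/-- Away from the only maximum, the potential is bounded away from its maximal value. -/
theorem exists_lt_of_isCompact {m : EuclideanSpace ℝ (Fin n)}
    {K : Set (EuclideanSpace ℝ (Fin n))} (hK : IsCompact K) (hKU : K ⊆ U)
    (hlt : ∀ x ∈ K, S x < S m) : ∃ μ < S m, ∀ x ∈ K, S x ≤ μ := by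
  rcases K.eq_empty_or_nonempty with rfl | hne
  · exact ⟨S m - 1, by linarith, by simp⟩
  · obtain ⟨y, hy, hmax⟩ := hK.exists_isMaxOn hne (h.continuousOn_potential.mono hKU)
    exact ⟨S y, hlt y hy, fun x hx => hmax hx⟩

end IsFluctuationGeometry

/-! ### Global flows and the gradient flow of the potential. -/

/-- A bounded and Lipschitz vector field has global integral curves. -/
theorem exists_integralCurve {F : Type*} [NormedAddCommGroup F] [NormedSpace ℝ F] [CompleteSpace F]
    {V : F → F} {K L : NNReal} (hK : LipschitzWith K V) (hL : ∀ x, ‖V x‖ ≤ L) (x : F) :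
    ∃ α : ℝ → F, α 0 = x ∧ ∀ t, HasDerivAt α (V (α t)) t := by
  have hloc : ∀ T : NNReal, ∃ α : ℝ → F, α 0 = x ∧
      ∀ t ∈ Ioo (-(T : ℝ)) T, HasDerivAt α (V (α t)) t := by
    intro T
    have hPL : IsPicardLindelof (fun _ : ℝ => V) (tmin := -(T : ℝ)) (tmax := T)
        ⟨0, by simp⟩ x (L * T) 0 L K :=
      { lipschitzOnWith := fun _ _ => hK.lipschitzOnWith
        continuousOn := fun _ _ => continuousOn_const
        norm_le := fun _ _ y _ => hL y
        mul_max_le := by simp }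
    obtain ⟨α, hα0, hα⟩ := hPL.exists_eq_forall_mem_Icc_hasDerivWithinAt₀
    exact ⟨α, hα0, fun t ht => (hα t (Ioo_subset_Icc_self ht)).hasDerivAt
      (Icc_mem_nhds ht.1 ht.2)⟩
  choose α hα0 hα using hloc
  have hagree : ∀ (T T' : NNReal) (t : ℝ), |t| < T → |t| < T' → α T t = α T' t := by
    intro T T' t ht ht'
    have hmin : |t| < min (T : ℝ) T' := lt_min ht ht'
    have h0 : (0 : ℝ) < min (T : ℝ) T' := (abs_nonneg t).trans_lt hmin
    refine ODE_solution_unique_of_mem_Ioo (v := fun _ => V) (s := fun _ => univ) (K := K)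
      (a := -min (T : ℝ) T') (b := min (T : ℝ) T') (t₀ := 0) (fun _ _ => hK.lipschitzOnWith)
      ⟨by linarith, h0⟩ (fun s hs => ⟨hα T s ⟨?_, ?_⟩, trivial⟩)
      (fun s hs => ⟨hα T' s ⟨?_, ?_⟩, trivial⟩) (by rw [hα0, hα0]) (abs_lt.mp hmin)
    · linarith [hs.1, min_le_left (T : ℝ) T']
    · linarith [hs.2, min_le_left (T : ℝ) T']
    · linarith [hs.1, min_le_right (T : ℝ) T']
    · linarith [hs.2, min_le_right (T : ℝ) T']
  have hlt : ∀ t : ℝ, |t| < (‖t‖₊ + 1 : NNReal) := fun t => by simp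
  refine ⟨fun t => α (‖t‖₊ + 1) t, hα0 _, fun t => ?_⟩
  refine (hα _ t (abs_lt.mp (hlt t))).congr_of_eventuallyEq ?_
  have hopen : ∀ᶠ s in 𝓝 t, |s| < ((‖t‖₊ + 1 : NNReal) : ℝ) :=
    continuous_abs.continuousAt.eventually_lt continuousAt_const (hlt t)
  filter_upwards [hopen] with s hs
  exact hagree _ _ s (hlt s) hs

/-- A bounded and Lipschitz vector field has a global flow. -/
theorem exists_flow {F : Type*} [NormedAddCommGroup F] [NormedSpace ℝ F] [CompleteSpace F]
    {V : F → F} {K L : NNReal} (hK : LipschitzWith K V) (hL : ∀ x, ‖V x‖ ≤ L) :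
    ∃ Φ : F → ℝ → F, (∀ x, Φ x 0 = x) ∧ (∀ x t, HasDerivAt (Φ x) (V (Φ x t)) t) ∧
      ∀ t ≥ 0, Continuous fun x => Φ x t := by
  choose Φ hΦ0 hΦ using exists_integralCurve hK hL
  refine ⟨Φ, hΦ0, hΦ, fun t ht => ?_⟩
  refine (LipschitzWith.of_dist_le_mul (K := ⟨Real.exp (K * t), (Real.exp_pos _).le⟩)
    fun x y => ?_).continuous
  have h1 := dist_le_of_trajectories_ODE (v := fun _ => V) (fun _ => hK)
    (a := 0) (b := t) (δ := dist x y) (f := Φ x) (g := Φ y)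
    (fun s _ => (hΦ x s).continuousAt.continuousWithinAt) (fun s _ => (hΦ x s).hasDerivWithinAt)
    (fun s _ => (hΦ y s).continuousAt.continuousWithinAt) (fun s _ => (hΦ y s).hasDerivWithinAt)
    (by rw [hΦ0, hΦ0]) t (right_mem_Icc.mpr ht)
  rw [sub_zero] at h1
  exact h1.trans_eq (mul_comm _ _)

/-- A `C¹` vector field on an open set, cut off outside a compact set. -/
theorem exists_cutoff {F : Type*} [NormedAddCommGroup F] [NormedSpace ℝ F]
    [FiniteDimensional ℝ F] {U K : Set F} (hU : IsOpen U) (hK : IsCompact K) (hKU : K ⊆ U)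
    {X : F → F} (hX : ContDiffOn ℝ 1 X U) :
    ∃ (χ : F → ℝ) (L L' : NNReal), (∀ x, 0 ≤ χ x) ∧ (∀ x ∈ K, χ x = 1) ∧
      LipschitzWith L (fun x => χ x • X x) ∧ ∀ x, ‖χ x • X x‖ ≤ L' := by
  obtain ⟨C, hC, hKC, hCU⟩ := exists_compact_between hK hU hKU
  obtain ⟨χ, hχ1, hχ0, hχ⟩ := exists_contMDiffMap_one_nhds_of_subset_interior (n := 1)
    (modelWithCornersSelf ℝ F) hK.isClosed hKC
  have hχd : ContDiff ℝ 1 χ := χ.contMDiff.contDiff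
  have hzero : ∀ x ∉ C, χ x • X x = 0 := fun x hx => by rw [hχ0 x hx, zero_smul]
  have hd : ContDiff ℝ 1 fun x => χ x • X x := by
    rw [contDiff_iff_contDiffAt]
    intro x
    by_cases hx : x ∈ U
    · exact hχd.contDiffAt.smul ((hX x hx).contDiffAt (hU.mem_nhds hx))
    · refine (contDiffAt_const (c := (0 : F))).congr_of_eventuallyEq ?_
      filter_upwards [hC.isClosed.isOpen_compl.mem_nhds fun hxC => hx (hCU hxC)] with y hy
      exact hzero y hy
  have hs : HasCompactSupport fun x => χ x • X x := HasCompactSupport.intro hC hzero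
  obtain ⟨L, hL⟩ := hd.lipschitzWith_of_hasCompactSupport hs one_ne_zero
  obtain ⟨L', hL'⟩ := hs.exists_bound_of_continuous hd.continuous
  exact ⟨χ, L, L'.toNNReal, fun x => (hχ x).1, fun x hx => hχ1.self_of_nhdsSet x hx, hL,
    fun x => (hL' x).trans (Real.le_coe_toNNReal L')⟩

/-- The riemannian gradient of `S`. -/
def gradientField {n : ℕ} (g : EuclideanSpace ℝ (Fin n) → Matrix (Fin n) (Fin n) ℝ)
    (S : EuclideanSpace ℝ (Fin n) → ℝ) (x : EuclideanSpace ℝ (Fin n)) :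
    EuclideanSpace ℝ (Fin n) :=
  cometric g x (fderiv ℝ S x)

namespace IsFluctuationGeometry

variable {n : ℕ} {U : Set (EuclideanSpace ℝ (Fin n))}
  {g : EuclideanSpace ℝ (Fin n) → Matrix (Fin n) (Fin n) ℝ}
  {S : EuclideanSpace ℝ (Fin n) → ℝ} {p : Measure (EuclideanSpace ℝ (Fin n))}
  (h : IsFluctuationGeometry U g S p)
include h

theorem contDiffOn_gradientField : ContDiffOn ℝ 1 (gradientField g S) U := fun _ hx =>
  (((h.isRiemannianMetric.contDiffAt_cometric hx).of_le (by norm_num)).clm_apply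
    ((h.contDiffAt_potential hx).fderiv_right (m := 1) (by norm_num))).contDiffWithinAt

/-- The gradient flow of the potential, on a superlevel set. -/
theorem exists_gradient_flow (c : ℝ) :
    ∃ Φ : EuclideanSpace ℝ (Fin n) → ℝ → EuclideanSpace ℝ (Fin n),
      (∀ t ≥ 0, Continuous fun x => Φ x t) ∧ ∀ x ∈ U, c ≤ S x → Φ x 0 = x ∧ ∀ t ≥ 0,
        Φ x t ∈ U ∧ HasDerivAt (Φ x) (gradientField g S (Φ x t)) t := by
  have hg := h.isRiemannianMetric
  have hK := h.isCompact_superlevel c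
  obtain ⟨χ, L, L', hχ0, hχ1, hL, hL'⟩ := exists_cutoff h.isOpen hK (fun x hx => hx.1)
    h.contDiffOn_gradientField
  obtain ⟨Φ, hΦ0, hΦ, hΦc⟩ := exists_flow hL hL'
  refine ⟨Φ, hΦc, fun x hx hcx => ⟨hΦ0 x, ?_⟩⟩
  have hcont : Continuous (Φ x) := continuous_iff_continuousAt.mpr fun t => (hΦ x t).continuousAt
  -- The cut-off field is a nonnegative multiple of the gradient on U, so S cannot decrease along
  -- it. By continuous induction the curve never leaves the superlevel set, where the cut-off is 1.
  have hstay : ∀ T ≥ 0, Φ x T ∈ {x | x ∈ U ∧ c ≤ S x} := by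
    intro T hT
    have hclosed : IsClosed (Φ x ⁻¹' {x | x ∈ U ∧ c ≤ S x}) := hK.isClosed.preimage hcont
    refine (hclosed.inter isClosed_Icc).Icc_subset_of_forall_mem_nhdsWithin (a := 0) (b := T)
      ?_ ?_ (right_mem_Icc.mpr hT)
    · rw [mem_preimage, hΦ0]
      exact ⟨hx, hcx⟩
    · rintro t ⟨htK, -⟩
      have htK : Φ x t ∈ U ∧ c ≤ S (Φ x t) := htK
      obtain ⟨ρ, hρ, hball⟩ := Metric.nhds_basis_ball.eventually_iff.mp
        (hcont.continuousAt.eventually (h.isOpen.mem_nhds htK.1))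
      have hU : ∀ s ∈ Ico t (t + ρ), Φ x s ∈ U := fun s hs => hball (by
        rw [Metric.mem_ball, Real.dist_eq, abs_lt]
        constructor <;> linarith [hs.1, hs.2])
      have hd : ∀ s ∈ Ico t (t + ρ), HasDerivAt (fun s => S (Φ x s))
          (fderiv ℝ S (Φ x s) (χ (Φ x s) • gradientField g S (Φ x s))) s := fun s hs =>
        ((h.contDiffAt_potential (hU s hs)).differentiableAt
          (by simp)).hasFDerivAt.comp_hasDerivAt s (hΦ x s)
      have hmono : MonotoneOn (fun s => S (Φ x s)) (Ico t (t + ρ)) := by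
        refine monotoneOn_of_deriv_nonneg (convex_Ico _ _)
          (fun s hs => (hd s hs).continuousAt.continuousWithinAt)
          (fun s hs => (hd s (interior_subset hs)).differentiableAt.differentiableWithinAt)
          fun s hs => ?_
        have hs := interior_subset hs
        rw [(hd s hs).deriv, map_smul, smul_eq_mul]
        exact mul_nonneg (hχ0 _) (hg.cometric_nonneg (hU s hs) _)
      filter_upwards [Ioo_mem_nhdsGT (show t < t + ρ by linarith)] with s hs
      have hs := Ioo_subset_Ico_self hs
      exact ⟨hU s hs, htK.2.trans (hmono ⟨le_rfl, by linarith⟩ hs hs.1)⟩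
  intro t ht
  refine ⟨(hstay t ht).1, ?_⟩
  have h1 := hΦ x t
  rwa [hχ1 _ (hstay t ht), one_smul] at h1

/-- The depth decays exponentially along the gradient flow. -/
theorem depth_gradient_flow {m : EuclideanSpace ℝ (Fin n)} (hm : m ∈ U) (hmax : IsMaxOn S U m)
    {α : ℝ → EuclideanSpace ℝ (Fin n)}
    (hα : ∀ t ≥ 0, α t ∈ U ∧ HasDerivAt α (gradientField g S (α t)) t) {T : ℝ} (hT : 0 ≤ T) :
    S m - S (α T) = Real.exp (-(2 * T)) * (S m - S (α 0)) := by
  -- Along the flow S has derivative |∇S|², which the eikonal equation turns into twice the depth.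
  have hd : ∀ t ≥ 0, HasDerivAt (fun t => Real.exp (2 * t) * (S m - S (α t))) 0 t := by
    intro t ht
    have h1 : HasDerivAt (fun t => S (α t)) (2 * (S m - S (α t))) t := by
      have := ((h.contDiffAt_potential (hα t ht).1).differentiableAt
        (by simp)).hasFDerivAt.comp_hasDerivAt t (hα t ht).2
      rwa [gradientField, h.eikonal hm hmax (hα t ht).1] at this
    have h2 : HasDerivAt (fun t : ℝ => Real.exp (2 * t)) (Real.exp (2 * t) * 2) t := by
      simpa using ((hasDerivAt_id t).const_mul 2).exp
    refine (h2.mul (h1.const_sub (S m))).congr_deriv ?_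
    ring
  have h1 := constant_of_has_deriv_right_zero (a := 0) (b := T)
    (fun t ht => (hd t ht.1).continuousAt.continuousWithinAt)
    (fun t ht => (hd t ht.1).hasDerivWithinAt) T (right_mem_Icc.mpr hT)
  simp only [mul_zero, Real.exp_zero, one_mul] at h1
  rw [← h1, ← mul_assoc, ← Real.exp_add]
  simp

end IsFluctuationGeometry

theorem exists_exp_mul_lt {a b : ℝ} (hb : 0 < b) : ∃ T ≥ 0, Real.exp (-(2 * T)) * a < b := by
  have h1 : Tendsto (fun T : ℝ => Real.exp (-(2 * T)) * a) atTop (𝓝 (0 * a)) :=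
    (Real.tendsto_exp_neg_atTop_nhds_zero.comp
      (tendsto_id.const_mul_atTop two_pos)).mul_const a
  rw [zero_mul] at h1
  obtain ⟨T, hT, hT'⟩ := ((eventually_ge_atTop 0).and (h1.eventually_lt_const hb)).exists
  exact ⟨T, hT, hT'⟩

/-! ### Uniqueness of the maximum. -/

namespace IsFluctuationGeometry

variable {n : ℕ} {U : Set (EuclideanSpace ℝ (Fin n))}
  {g : EuclideanSpace ℝ (Fin n) → Matrix (Fin n) (Fin n) ℝ}
  {S : EuclideanSpace ℝ (Fin n) → ℝ} {p : Measure (EuclideanSpace ℝ (Fin n))}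
  (h : IsFluctuationGeometry U g S p)
include h

/-- The gradient flow fixes the maxima of the potential. -/
theorem gradient_flow_eq_self {m : EuclideanSpace ℝ (Fin n)} (hm : m ∈ U) (hmax : IsMaxOn S U m)
    {α : ℝ → EuclideanSpace ℝ (Fin n)}
    (hα : ∀ t ≥ 0, α t ∈ U ∧ HasDerivAt α (gradientField g S (α t)) t)
    (h0 : S (α 0) = S m) {T : ℝ} (hT : 0 ≤ T) : α T = α 0 := by
  have hzero : ∀ t ≥ 0, gradientField g S (α t) = 0 := by
    intro t ht
    have h1 := h.depth_gradient_flow hm hmax hα ht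
    rw [h0, sub_self, mul_zero] at h1
    have h2 := h.eikonal hm hmax (hα t ht).1
    rw [h1, mul_zero] at h2
    rw [gradientField, h.isRiemannianMetric.cometric_eq_zero (hα t ht).1 h2, map_zero]
  refine constant_of_has_deriv_right_zero (a := 0) (b := T)
    (fun t ht => (hα t ht.1).2.continuousAt.continuousWithinAt)
    (fun t ht => ?_) T (right_mem_Icc.mpr hT)
  rw [← hzero t ht.1]
  exact (hα t ht.1).2.hasDerivWithinAt

/-- A mountain pass argument: the gradient flow lifts a path between two maxima uniformly close to
the maximal level while fixing its ends, yet the path must cross a small sphere around m on which S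
stays below that level. -/
theorem isMaxOn_unique {m m' : EuclideanSpace ℝ (Fin n)} (hm : m ∈ U) (hmax : IsMaxOn S U m)
    (hm' : m' ∈ U) (hmax' : IsMaxOn S U m') : m' = m := by
  by_contra hne
  have hSm : S m' = S m := le_antisymm (hmax hm') (hmax' hm)
  have hev := h.eventually_fderiv_ne_zero hm hmax
  rw [eventually_nhdsWithin_iff] at hev
  obtain ⟨ρ, hρ, hball⟩ := Metric.nhds_basis_ball.eventually_iff.mp hev
  have hisol : ∀ y ∈ U, y ≠ m → ‖y - m‖ < ρ → S y < S m := by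
    intro y hy hym hyρ
    refine lt_of_le_of_ne (hmax hy) fun heq => ?_
    have hmaxy : IsMaxOn S U y := fun z hz => (hmax hz).trans_eq heq.symm
    exact hball (mem_ball_iff_norm.mpr hyρ) hym (h.fderiv_eq_zero_of_isMaxOn hy hmaxy)
  have hfar : ρ ≤ ‖m' - m‖ := by
    by_contra hlt
    exact (hisol m' hm' hne (not_le.mp hlt)).ne hSm
  obtain ⟨C, hC⟩ := (h.isOpen.isConnected_iff_isPathConnected.mp h.isConnected).joinedIn m hm m' hm'
  set R := range C with hR
  have hRU : R ⊆ U := range_subset_iff.mpr hC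
  have hRc : IsCompact R := isCompact_range C.continuous
  have hmR : m ∈ R := ⟨0, C.source⟩
  have hmR' : m' ∈ R := ⟨1, C.target⟩
  obtain ⟨y₀, hy₀, hmin⟩ := hRc.exists_isMinOn ⟨m, hmR⟩ (h.continuousOn_potential.mono hRU)
  obtain ⟨Φ, hΦc, hΦ⟩ := h.exists_gradient_flow (S y₀)
  have hsphere : IsCompact ({x | x ∈ U ∧ S y₀ ≤ S x} ∩ Metric.sphere m (ρ / 2)) :=
    (h.isCompact_superlevel _).inter_right Metric.isClosed_sphere
  obtain ⟨μ, hμ, hμle⟩ := h.exists_lt_of_isCompact (m := m) hsphere (fun x hx => hx.1.1)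
    (fun x hx => by
      have h1 := mem_sphere_iff_norm.mp hx.2
      refine hisol x hx.1.1 (fun h2 => ?_) (by rw [h1]; linarith)
      rw [h2, sub_self, norm_zero] at h1
      linarith)
  -- The lowest point y₀ of the path has the greatest depth. At time T every point of the path has
  -- flowed to depth below S(m) - μ, less than any depth on the relevant part of the sphere.
  obtain ⟨T, hT, hTlt⟩ := exists_exp_mul_lt (a := S m - S y₀) (b := S m - μ) (by linarith)
  have hfix : ∀ z ∈ R, S z = S m → Φ z T = z := by
    intro z hz hSz
    have h1 := hΦ z (hRU hz) (hmin hz)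
    have h2 := h.gradient_flow_eq_self hm hmax h1.2 (by rw [h1.1, hSz]) hT
    rw [h2, h1.1]
  have hconn : IsPreconnected R := isPreconnected_range C.continuous
  have hivt := hconn.intermediate_value hmR hmR' (f := fun x => ‖Φ x T - m‖)
    (((hΦc T hT).sub continuous_const).norm.continuousOn)
  simp only [hfix m hmR rfl, hfix m' hmR' hSm, sub_self, norm_zero] at hivt
  obtain ⟨z, hz, hzρ⟩ := hivt (show ρ / 2 ∈ Icc 0 ‖m' - m‖ from ⟨by linarith, by linarith⟩)
  have hzρ : ‖Φ z T - m‖ = ρ / 2 := hzρ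
  obtain ⟨hz0, hzα⟩ := hΦ z (hRU hz) (hmin hz)
  have hdepth := h.depth_gradient_flow hm hmax hzα hT
  rw [hz0] at hdepth
  have hzy : S y₀ ≤ S z := hmin hz
  have h1 : Real.exp (-(2 * T)) * (S m - S z) ≤ Real.exp (-(2 * T)) * (S m - S y₀) :=
    mul_le_mul_of_nonneg_left (by linarith) (Real.exp_pos _).le
  have h2 : Real.exp (-(2 * T)) * (S m - S z) ≤ S m - S z := by
    refine mul_le_of_le_one_left (sub_nonneg.mpr (hmax (hRU hz))) ?_
    exact Real.exp_le_one_iff.mpr (by linarith)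
  have h3 := hμle (Φ z T) ⟨⟨(hzα T hT).1, by linarith⟩, mem_sphere_iff_norm.mpr hzρ⟩
  linarith

theorem lt_of_ne {m : EuclideanSpace ℝ (Fin n)} (hm : m ∈ U) (hmax : IsMaxOn S U m)
    {x : EuclideanSpace ℝ (Fin n)} (hx : x ∈ U) (hne : x ≠ m) : S x < S m := by
  refine lt_of_le_of_ne (hmax hx) fun heq => hne ?_
  exact h.isMaxOn_unique hm hmax hx fun z hz => (hmax hz).trans_eq heq.symm

/-! ### The distance to the maximum. -/

/-- Points whose potential tends to its maximal value tend to the maximum. -/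
theorem tendsto_of_depth {m : EuclideanSpace ℝ (Fin n)} (hm : m ∈ U) (hmax : IsMaxOn S U m)
    {ι : Type*} {l : Filter ι} {α : ι → EuclideanSpace ℝ (Fin n)} (hα : ∀ᶠ i in l, α i ∈ U)
    (hlim : Tendsto (fun i => S (α i)) l (𝓝 (S m))) : Tendsto α l (𝓝 m) := by
  rw [tendsto_nhds]
  intro W hW hmW
  have hK : IsCompact ({x | x ∈ U ∧ S m - 1 ≤ S x} \ W) := (h.isCompact_superlevel _).diff hW
  obtain ⟨μ, hμ, hμle⟩ := h.exists_lt_of_isCompact (m := m) hK (fun x hx => hx.1.1)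
    (fun x hx => h.lt_of_ne hm hmax hx.1.1 fun h1 => hx.2 (h1 ▸ hmW))
  filter_upwards [hα, hlim.eventually_const_lt hμ,
    hlim.eventually_const_lt (show S m - 1 < S m by linarith)] with i h1 h2 h3
  by_contra h4
  exact absurd (hμle _ ⟨⟨h1, h3.le⟩, h4⟩) (not_le.mpr h2)

/-- The gradient line from a point to the maximum, as a `C¹` curve on a compact interval. -/
theorem exists_curve_length_eq {m : EuclideanSpace ℝ (Fin n)} (hm : m ∈ U) (hmax : IsMaxOn S U m)
    {x : EuclideanSpace ℝ (Fin n)} (hx : x ∈ U) :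
    ∃ c : ℝ → EuclideanSpace ℝ (Fin n), IsCurve U c (-1) 0 x m ∧
      length g c (-1) 0 = Real.sqrt (2 * (S m - S x)) := by
  have hg := h.isRiemannianMetric
  obtain ⟨Φ, -, hΦ⟩ := h.exists_gradient_flow (S x)
  obtain ⟨hα0, hα⟩ := hΦ x hx le_rfl
  set r := Real.sqrt (2 * (S m - S x)) with hr
  have hr2 : r ^ 2 = 2 * (S m - S x) := Real.sq_sqrt (by linarith [show S x ≤ S m from hmax hx])
  -- The flow reaches m only at infinite time, so it is run at time -2 log|s| with s increasing from
  -- -1 to 0 (`Real.log` is even). The depth is then s⁴ times its initial value and the speed is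
  -- 2r|s|. The factor 2 makes the velocity tend to zero, so c is C¹ up to s = 0 without any study
  -- of the limiting direction.
  set c : ℝ → EuclideanSpace ℝ (Fin n) := fun s => if s = 0 then m else Φ x (-2 * Real.log s)
    with hc
  have hc0 : c 0 = m := by simp [hc]
  have hcne : ∀ s, s ≠ 0 → c s = Φ x (-2 * Real.log s) := fun s hs => by simp [hc, hs]
  have htime : ∀ s ∈ Ico (-1 : ℝ) 0, 0 ≤ -2 * Real.log s := by
    intro s hs
    have h1 : Real.log s ≤ 0 := by
      rw [← Real.log_neg_eq_log]
      exact Real.log_nonpos (by linarith [hs.2]) (by linarith [hs.1])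
    linarith
  have hU : ∀ s ∈ Icc (-1 : ℝ) 0, c s ∈ U := by
    intro s hs
    rcases eq_or_ne s 0 with rfl | hne
    · rwa [hc0]
    · rw [hcne s hne]
      exact (hα _ (htime s ⟨hs.1, lt_of_le_of_ne hs.2 hne⟩)).1
  have hdepth : ∀ s ∈ Icc (-1 : ℝ) 0, 2 * (S m - S (c s)) = (r * s ^ 2) ^ 2 := by
    intro s hs
    rcases eq_or_ne s 0 with rfl | hne
    · simp [hc0]
    · have hs' : s ∈ Ico (-1 : ℝ) 0 := ⟨hs.1, lt_of_le_of_ne hs.2 hne⟩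
      have h1 : Real.exp (-(2 * (-2 * Real.log s))) = s ^ 4 := by
        rw [← Real.log_neg_eq_log, show -(2 * (-2 * Real.log (-s))) = (4 : ℕ) * Real.log (-s) by
          push_cast; ring, Real.exp_nat_mul, Real.exp_log (by linarith [hs'.2])]
        ring
      rw [hcne s hne, h.depth_gradient_flow hm hmax hα (htime s hs'), hα0, mul_pow, hr2, h1]
      ring
  set v : ℝ → EuclideanSpace ℝ (Fin n) := fun s => (-2 / s) • gradientField g S (c s) with hv
  have hv0 : v 0 = 0 := by simp [hv]
  have hspeed : ∀ s ∈ Icc (-1 : ℝ) 0, metricForm g (c s) (v s) (v s) = (2 * r * s) ^ 2 := by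
    intro s hs
    rcases eq_or_ne s 0 with rfl | hne
    · simp [hv0]
    · have h1 : fderiv ℝ S (c s) (gradientField g S (c s)) = (r * s ^ 2) ^ 2 := by
        rw [gradientField, h.eikonal hm hmax (hU s hs), hdepth s hs]
      have h2 : metricForm g (c s) (gradientField g S (c s)) = fderiv ℝ S (c s) :=
        hg.metricForm_cometric (hU s hs) _
      simp only [hv, map_smul, smul_apply, smul_eq_mul, h2, h1]
      field_simp
  have hd : ∀ s ∈ Ico (-1 : ℝ) 0, HasDerivAt c (v s) s := by
    intro s hs
    have h1 : HasDerivAt (fun s => -2 * Real.log s) (-2 / s) s :=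
      ((Real.hasDerivAt_log hs.2.ne).const_mul (-2)).congr_deriv (by rw [div_eq_mul_inv])
    have h2 := (hα _ (htime s hs)).2.scomp s h1
    rw [← hcne s hs.2.ne] at h2
    refine h2.congr_of_eventuallyEq ?_
    filter_upwards [isOpen_ne.mem_nhds hs.2.ne] with y hy
    exact hcne y hy
  have hc_tendsto : Tendsto c (𝓝[Icc (-1) 0] 0) (𝓝 m) := by
    refine h.tendsto_of_depth hm hmax (eventually_mem_nhdsWithin.mono hU) ?_
    have h1 : Tendsto (fun s : ℝ => S m - (r * s ^ 2) ^ 2 / 2) (𝓝[Icc (-1) 0] 0) (𝓝 (S m)) := by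
      have : Continuous fun s : ℝ => S m - (r * s ^ 2) ^ 2 / 2 := by fun_prop
      simpa using (this.tendsto 0).mono_left nhdsWithin_le_nhds
    refine h1.congr' (eventually_mem_nhdsWithin.mono fun s hs => ?_)
    linarith [hdepth s hs]
  have hv_tendsto : Tendsto v (𝓝[Icc (-1) 0] 0) (𝓝 0) := by
    obtain ⟨k, hk, ρ, hρ, -, hkρ⟩ := hg.exists_mul_norm_le hm
    have h1 : Tendsto (fun s : ℝ => |2 * r * s| / k) (𝓝[Icc (-1) 0] 0) (𝓝 0) := by
      have : Continuous fun s : ℝ => |2 * r * s| / k := by fun_prop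
      simpa using (this.tendsto 0).mono_left nhdsWithin_le_nhds
    refine squeeze_zero_norm' ?_ h1
    filter_upwards [eventually_mem_nhdsWithin,
      hc_tendsto.eventually (Metric.closedBall_mem_nhds m hρ)] with s hs hs'
    have h2 := hkρ _ hs' (v s)
    rw [hspeed s hs, Real.sqrt_sq_eq_abs] at h2
    rwa [le_div_iff₀' hk]
  have hIoo : Ioo (-1 : ℝ) 0 ⊆ Icc (-1) 0 := Ioo_subset_Icc_self
  have hleft : 𝓝[<] (0 : ℝ) ≤ 𝓝[Icc (-1) 0] 0 := by
    rw [← nhdsWithin_Ioo_eq_nhdsLT (show (-1 : ℝ) < 0 by norm_num)]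
    exact nhdsWithin_mono _ hIoo
  -- The one-sided derivative at the end point is the limit of the derivatives before it.
  have hd0 : HasDerivWithinAt c (v 0) (Iic 0) 0 := by
    rw [hv0]
    refine hasDerivWithinAt_Iic_of_tendsto_deriv (s := Ioo (-1) 0)
      (fun s hs => (hd s (Ioo_subset_Ico_self hs)).differentiableAt.differentiableWithinAt)
      ?_ (Ioo_mem_nhdsLT (by norm_num)) ?_
    · rw [ContinuousWithinAt, hc0]
      exact hc_tendsto.mono_left (nhdsWithin_mono _ hIoo)
    · refine (hv_tendsto.mono_left hleft).congr' ?_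
      filter_upwards [Ioo_mem_nhdsLT (show (-1 : ℝ) < 0 by norm_num)] with s hs
      exact (hd s (Ioo_subset_Ico_self hs)).deriv.symm
  have hdw : ∀ s ∈ Icc (-1 : ℝ) 0, HasDerivWithinAt c (v s) (Icc (-1) 0) s := by
    intro s hs
    rcases eq_or_lt_of_le hs.2 with rfl | hlt
    · exact hd0.mono fun y hy => hy.2
    · exact (hd s ⟨hs.1, hlt⟩).hasDerivWithinAt
  have huniq := uniqueDiffOn_Icc (show (-1 : ℝ) < 0 by norm_num)
  have hvc : ContinuousOn v (Icc (-1) 0) := by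
    intro s hs
    rcases eq_or_lt_of_le hs.2 with rfl | hlt
    · rw [ContinuousWithinAt, hv0]
      exact hv_tendsto
    · have h1 : ContinuousAt (fun s => gradientField g S (c s)) s :=
        ContinuousAt.comp (g := gradientField g S)
          ((h.contDiffOn_gradientField.continuousOn).continuousAt (h.isOpen.mem_nhds (hU s hs)))
          (hd s ⟨hs.1, hlt⟩).continuousAt
      exact ((continuousAt_const.div continuousAt_id hlt.ne).smul h1).continuousWithinAt
  have hcd : ContDiffOn ℝ 1 c (Icc (-1) 0) := by
    rw [show (1 : WithTop ℕ∞) = 0 + 1 from (zero_add 1).symm,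
      contDiffOn_succ_iff_derivWithin huniq]
    refine ⟨fun s hs => (hdw s hs).differentiableWithinAt, by simp, ?_⟩
    rw [contDiffOn_zero]
    exact hvc.congr fun s hs => (hdw s hs).derivWithin (huniq s hs)
  refine ⟨c, ⟨by norm_num, hcd, hU, ?_, hc0⟩, ?_⟩
  · rw [hcne _ (by norm_num)]
    simpa using hα0
  · have h1 : length g c (-1) 0 = ∫ t in (-1 : ℝ)..0, (-2 * r) * t := by
      refine intervalIntegral.integral_congr_ae ?_
      filter_upwards [Measure.ae_ne volume (0 : ℝ)] with t ht htI
      rw [uIoc_of_le (by norm_num)] at htI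
      have ht0 : t < 0 := lt_of_le_of_ne htI.2 ht
      rw [quadForm_eq, (hd t ⟨htI.1.le, ht0⟩).deriv, hspeed t ⟨htI.1.le, htI.2⟩,
        Real.sqrt_sq_eq_abs, abs_of_nonpos]
      · ring
      · exact mul_nonpos_of_nonneg_of_nonpos (by positivity) ht0.le
    rw [h1, intervalIntegral.integral_const_mul, integral_id]
    ring

/-- The distance to the maximum of the potential. -/
theorem distance_eq {m : EuclideanSpace ℝ (Fin n)} (hm : m ∈ U) (hmax : IsMaxOn S U m)
    {x : EuclideanSpace ℝ (Fin n)} (hx : x ∈ U) :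
    distance U g x m = Real.sqrt (2 * (S m - S x)) := by
  obtain ⟨c, hc, hlen⟩ := h.exists_curve_length_eq hm hmax hx
  refine IsLeast.csInf_eq ⟨⟨c, -1, 0, hc, hlen.symm⟩, ?_⟩
  rintro L ⟨c', a, b, hc', rfl⟩
  exact h.sqrt_le_length hm hmax hc'

/-! ### The gaussian form of the distribution. -/

theorem exp_potential_eq {m : EuclideanSpace ℝ (Fin n)} (hm : m ∈ U) (hmax : IsMaxOn S U m)
    {x : EuclideanSpace ℝ (Fin n)} (hx : x ∈ U) :
    Real.exp (S x) = Real.exp (S m) * Real.exp (-(1 / 2) * distance U g x m ^ 2) := by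
  have h1 : S x ≤ S m := hmax hx
  rw [h.distance_eq hm hmax hx, Real.sq_sqrt (by linarith), ← Real.exp_add]
  congr 1
  ring

omit h in
theorem ae_invariantVolume (hU : IsOpen U) : ∀ᵐ x ∂(invariantVolume U g), x ∈ U :=
  (withDensity_absolutelyContinuous _ _).ae_le (ae_restrict_mem hU.measurableSet)

theorem integral_exp_potential : ∫ x, Real.exp (S x) ∂(invariantVolume U g) = 1 := by
  have hp := h.isProbabilityMeasure.measure_univ
  rw [h.distribution_eq, withDensity_apply _ MeasurableSet.univ, Measure.restrict_univ] at hp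
  have hmeas : AEStronglyMeasurable (fun x => Real.exp (S x)) (invariantVolume U g) :=
    ((Real.continuous_exp.comp_continuousOn h.continuousOn_potential).aestronglyMeasurable
      h.isOpen.measurableSet).mono_ac (withDensity_absolutelyContinuous _ _)
  rw [integral_eq_lintegral_of_nonneg_ae (Eventually.of_forall fun _ => (Real.exp_pos _).le) hmeas,
    hp, ENNReal.toReal_one]

/-- The total mass 1 of p is e^{S(m)} times the gaussian integral. Thus S(m) is determined by the
metric and m. -/
theorem exp_neg_eq_integral {m : EuclideanSpace ℝ (Fin n)} (hm : m ∈ U) (hmax : IsMaxOn S U m) :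
    Real.exp (-S m) =
      ∫ x, Real.exp (-(1 / 2) * distance U g x m ^ 2) ∂(invariantVolume U g) := by
  have h1 := h.integral_exp_potential
  rw [integral_congr_ae ((ae_invariantVolume h.isOpen).mono fun x hx =>
    h.exp_potential_eq hm hmax hx), integral_const_mul] at h1
  rw [Real.exp_neg]
  exact inv_eq_of_mul_eq_one_right h1

theorem distribution_eq_withDensity {m : EuclideanSpace ℝ (Fin n)} (hm : m ∈ U)
    (hmax : IsMaxOn S U m) :
    p = (invariantVolume U g).withDensity (fun x => ENNReal.ofReal
      ((Real.exp (-S m))⁻¹ * Real.exp (-(1 / 2) * distance U g x m ^ 2))) := by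
  rw [h.distribution_eq]
  refine withDensity_congr_ae ((ae_invariantVolume h.isOpen).mono fun x hx => ?_)
  simp only
  rw [h.exp_potential_eq hm hmax hx, Real.exp_neg, inv_inv]

end IsFluctuationGeometry

end FluctuationGeometry

end

theorem mainTheorem5 {n : ℕ} (U : Set (EuclideanSpace ℝ (Fin n)))
    (g : EuclideanSpace ℝ (Fin n) → Matrix (Fin n) (Fin n) ℝ)
    (S : EuclideanSpace ℝ (Fin n) → ℝ) (p : Measure (EuclideanSpace ℝ (Fin n)))
    (h : FluctuationGeometry.IsFluctuationGeometry U g S p) :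
    ∃ Ibar ∈ U,
      -- `Ibar` is the unique stationary point and the unique global maximum of `S`
      (∀ I ∈ U, fderiv ℝ S I = 0 ↔ I = Ibar) ∧
      (∀ I ∈ U, I ≠ Ibar → S I < S Ibar) ∧
      -- the Riemannian gaussian representation
      (∃ Z : ℝ, 0 < Z ∧ S Ibar = -Real.log Z ∧
        Z = ∫ I, Real.exp (-(1 / 2) * FluctuationGeometry.distance U g I Ibar ^ 2)
              ∂(FluctuationGeometry.invariantVolume U g) ∧
        p = (FluctuationGeometry.invariantVolume U g).withDensity (fun I =>
              ENNReal.ofReal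
                (Z⁻¹ * Real.exp (-(1 / 2) * FluctuationGeometry.distance U g I Ibar ^ 2)))) ∧
      -- the metric and the maximum point alone determine the distribution
      (∀ (S' : EuclideanSpace ℝ (Fin n) → ℝ) (p' : Measure (EuclideanSpace ℝ (Fin n))),
        FluctuationGeometry.IsFluctuationGeometry U g S' p' →
          IsMaxOn S' U Ibar → p' = p) := by
  obtain ⟨m, hm, hmax⟩ := h.exists_isMaxOn
  refine ⟨m, hm, fun x hx => ⟨fun h0 => ?_, ?_⟩, fun x hx hne => h.lt_of_ne hm hmax hx hne,
    ⟨Real.exp (-S m), Real.exp_pos _, by rw [Real.log_exp, neg_neg],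
      h.exp_neg_eq_integral hm hmax, h.distribution_eq_withDensity hm hmax⟩, fun S' p' h' hmax' => ?_⟩
  · by_contra hne
    exact (h.lt_of_ne hm hmax hx hne).ne (h.eq_of_fderiv_eq_zero hm hmax hx h0)
  · rintro rfl
    exact h.fderiv_eq_zero_of_isMaxOn hm hmax
  -- Replacing e^{-S(m)} and e^{-S'(m)} by the same gaussian integral leaves two expressions in U, g
  -- and m only.
  · rw [h.distribution_eq_withDensity hm hmax, h'.distribution_eq_withDensity hm hmax',
      h.exp_neg_eq_integral hm hmax, h'.exp_neg_eq_integral hm hmax']
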